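/- Let $G$ be a finite weighted directed graph (self-loops allowed) with complex adjacency matrix $\mathsf A$: there is an edge $i\to j$ iff $\mathsf A_{ij}\neq0$, and $\mathsf A_{ij}$ is its weight (for an unweighted graph all weights are $1$ and "weight" below means "number"). A simple cycle (prime) is a closed walk without repeated vertex, up to its starting point. Hikes are the elements of the monoid generated by the simple cycles in which two simple cycles commute iff they are vertex-disjoint. The length $\ell$ and the weight $\mathrm{wt}$ of a hike are the sum of the lengths, resp. the product of the weights, of its prime factors; a prime $q$ right-divides $h$ if $h=gq$ for some hike $g$. Let $|\mathcal H_l|$ be the total weight of the hikes of length $l$, $\zeta(z)=\sum_{h}\mathrm{wt}(h)z^{\ell(h)}$, and $f(l)=[z^l]\zeta(z/\lambda)$, with $f(l)=0$ for $l<0$. A hike is a closed walk with unique right prime divisor $p$ if $p$ is the only prime that right-divides it. Assume that $\lambda\neq0$ is the unique dominant eigenvalue of $\mathsf A$: it has algebraic multiplicity one and every other eigenvalue has strictly smaller modulus. Then $f$ is bounded, $\lim_{l\to\infty}f(l)$ exists, and $|\mathcal H_l|\neq 0$ for all large $l$. Let $p$ be a simple cycle or a simple path on $G$ with $\ell(p)$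 edges and weight $\mathrm{wt}(p)$, let $G\backslash p$ be the subgraph induced by the vertices not on $p$, and let $S_p(l)$ be the total weight of the hikes of length $l-\ell(p)$ that are not right-divisible by any prime of $G\backslash p$ (so $S_p(l)=0$ for $l<\ell(p)$). 1. If $p$ is a simple cycle, then for all $l\ge0$ the total weight $N_p(l)$ of the closed walks of length $l$ with unique right prime divisor $p$ is $N_p(l)=\mathrm{wt}(p)\,S_p(l)$. For each vertex $v$ of $p$, it is also the total weight of the walks of length $l$ from $v$ to $v$ whose last loop erased by chronological loop-erasure is $p$. If $p$ is a simple path from $u$ to $v$, then $\mathrm{wt}(p)\,S_p(l)$ is the total weight of the walks of length $l$ from $u$ to $v$ whose loop-erasure is $p$. 2. As $l\to\infty$, $$\frac{S_p(l)}{|\mathcal H_l|}\longrightarrow \lambda^{-\ell(p)}\det\Big(\mathsf I-\frac1\lambda\mathsf A_{G\backslash p}\Big),$$ and hence, for a simple cycle $p$, $N_p(l)/|\mathcal H_l|\to \mathrm{wt}(p)\,\lambda^{-\ell(p)}\det(\mathsf I-\frac1\lambda\mathsf A_{G\backslash p})$, where $\mathrm{wt}(p)=1$ if $G$ is unweighted.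 3. For every $l\ge 0$ with $|\mathcal H_l|\ne0$, $$\frac{S_p(l)}{|\mathcal H_l|}-\lambda^{-\ell(p)}\det\Big(\mathsf I-\frac1\lambda\mathsf A_{G\backslash p}\Big)=\frac1{\lambda^{\ell(p)}}\sum_{k\ge0}\left(\frac{(-1)^k\,\nabla^k[f]\big(l-\ell(p)\big)}{f(l)\,\lambda^k\,k!}-\delta_{k,0}\right)D^{(k)}(1/\lambda),$$ where $D(z)=\det(\mathsf I-z\mathsf A_{G\backslash p})$, $D^{(k)}$ is its $k$-th derivative, $\nabla[F](x)=F(x)-F(x-1)$, and $\nabla^k$ is the $k$-th iterate of $\nabla$. -/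

import Mathlib

open Filter Topology

namespace HikeSieve

noncomputable section

/-! A finite weighted directed graph on `V` is given by its adjacency matrix `A`: there is an edge
from `i` to `j` exactly when `A i j ≠ 0`, and `A i j` is then its weight.  Self-loops are allowed.
An unweighted graph is the case in which all entries of `A` are `0` or `1`. -/

/-- The edge relation of the graph with adjacency matrix `A`. -/
def Edge {V : Type*} (A : Matrix V V ℂ) (i j : V) : Prop := A i j ≠ 0

/-- The product of the weights of the edges of a cyclic sequence of vertices, the edge from the last
vertex back to the first one included. -/
def cycleWeight {V : Type*} (A : Matrix V V ℂ) (c : Cycle V) : ℂ :=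
  Quotient.liftOn' c (fun l : List V => (List.zipWith (fun i j => A i j) l (l.rotate 1)).prod) (by
    rintro l _ ⟨n, rfl⟩
    have h : (l.rotate n).rotate 1 = (l.rotate 1).rotate n := by
      rw [List.rotate_rotate, List.rotate_rotate, Nat.add_comm]
    have h2 := List.zipWith_rotate_distrib (f := fun i j => A i j) l (l.rotate 1) n (by simp)
    simp only [h, ← h2]
    exact ((List.rotate_perm _ n).prod_eq).symm)

/-- The product of the weights of the edges of a sequence of vertices `v₀ v₁ … vₗ`. -/
def walkWeight {V : Type*} (A : Matrix V V ℂ) (w : List V) : ℂ :=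
  (List.zipWith (fun i j => A i j) w w.tail).prod

/-- A simple cycle (a prime): a closed walk on the graph without repeated vertex, up to the choice of
its starting point.  A self-loop is a simple cycle of length `1`; the two orientations of a cycle
are distinct. -/
structure SimpleCycle {V : Type*} (A : Matrix V V ℂ) where
  /-- the vertices in cyclic order -/
  toCycle : Cycle V
  ne_nil : toCycle ≠ Cycle.nil
  nodup : toCycle.Nodup
  chain : toCycle.Chain (Edge A)

/-- A simple path: a nonempty sequence of distinct vertices, consecutive ones joined by an edge. -/
structure SimplePath {V : Type*} (A : Matrix V V ℂ) where
  /-- the vertices, in order -/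
  toList : List V
  ne_nil : toList ≠ []
  nodup : toList.Nodup
  chain : toList.IsChain (Edge A)

section Graph

variable {V : Type*} {A : Matrix V V ℂ}

/-- The set of vertices of a simple cycle. -/
def SimpleCycle.verts (p : SimpleCycle A) : Set V := {v | v ∈ p.toCycle}

/-- The length (number of edges) of a simple cycle. -/
def SimpleCycle.length (p : SimpleCycle A) : ℕ := p.toCycle.length

/-- The weight of a simple cycle. -/
def SimpleCycle.weight (p : SimpleCycle A) : ℂ := cycleWeight A p.toCycle

/-- The set of vertices of a simple path. -/
def SimplePath.verts (p : SimplePath A) : Set V := {v | v ∈ p.toList}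

/-- The length (number of edges) of a simple path. -/
def SimplePath.length (p : SimplePath A) : ℕ := p.toList.length - 1

/-- The weight of a simple path. -/
def SimplePath.weight (p : SimplePath A) : ℂ := walkWeight A p.toList

end Graph

/-! ### Hikes -/

/-- Two consecutive vertex-disjoint simple cycles in a word may be exchanged. -/
def CommRel {V : Type*} (A : Matrix V V ℂ) (x y : FreeMonoid (SimpleCycle A)) : Prop :=
  ∃ p q : SimpleCycle A, Disjoint p.verts q.verts ∧
    x = FreeMonoid.of p * FreeMonoid.of q ∧ y = FreeMonoid.of q * FreeMonoid.of p

/-- The Cartier-Foata monoid of hikes: words on the simple cycles of the graph, modulo exchanges of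
consecutive vertex-disjoint simple cycles. -/
abbrev Hike {V : Type*} (A : Matrix V V ℂ) : Type _ := PresentedMonoid (CommRel A)

section Hikes

variable {V : Type*} {A : Matrix V V ℂ}

/-- A simple cycle, seen as a hike. -/
def prime (p : SimpleCycle A) : Hike A := PresentedMonoid.of (CommRel A) p

/-- The length of hikes, as a homomorphism to the additive monoid `ℕ`. -/
def lengthHom (A : Matrix V V ℂ) : Hike A →* Multiplicative ℕ :=
  PresentedMonoid.lift (fun p : SimpleCycle A => Multiplicative.ofAdd p.length) (by
    rintro _ _ ⟨p, q, -, rfl, rfl⟩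
    simp only [map_mul, FreeMonoid.lift_eval_of]
    exact mul_comm _ _)

/-- The weight of hikes, totally multiplicative. -/
def weightHom (A : Matrix V V ℂ) : Hike A →* ℂ :=
  PresentedMonoid.lift (fun p : SimpleCycle A => p.weight) (by
    rintro _ _ ⟨p, q, -, rfl, rfl⟩
    simp only [map_mul, FreeMonoid.lift_eval_of]
    exact mul_comm _ _)

/-- The length of a hike: the sum of the lengths of its prime factors. -/
def hikeLength (h : Hike A) : ℕ := Multiplicative.toAdd (lengthHom A h)

/-- The weight of a hike: the product of the weights of its prime factors. -/
def hikeWeight (h : Hike A) : ℂ := weightHom A h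

/-- The prime `p` is a right divisor of the hike `h`, that is, `h` is a (left) multiple of `p`. -/
def RightDvd (p : SimpleCycle A) (h : Hike A) : Prop := ∃ g : Hike A, h = g * prime p

/-- The set of all hikes of length `n`; it is empty when `n < 0`. -/
def hikesOfLength (A : Matrix V V ℂ) (n : ℤ) : Set (Hike A) := {h | (hikeLength h : ℤ) = n}

/-- The set of primes of the subgraph induced by the complement of the set of vertices `U`. -/
def primesOff (A : Matrix V V ℂ) (U : Set V) : Set (SimpleCycle A) := {q | q.verts ⊆ Uᶜ}

/-- The set of hikes of length `n` that are not multiples of a prime in the set `P`. -/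
def sievedHikes (A : Matrix V V ℂ) (n : ℤ) (P : Set (SimpleCycle A)) : Set (Hike A) :=
  {h | h ∈ hikesOfLength A n ∧ ∀ q ∈ P, ¬ RightDvd q h}

/-- The set of hikes of length `n` that are closed walks with unique right prime divisor `p`. -/
def walkHikes (A : Matrix V V ℂ) (n : ℤ) (p : SimpleCycle A) : Set (Hike A) :=
  {h | h ∈ hikesOfLength A n ∧ ∀ q, RightDvd q h ↔ q = p}

/-- The total weight of a set of hikes (its cardinality, if the graph is unweighted). -/
def totalWeight (S : Set (Hike A)) : ℂ := ∑ᶠ h ∈ S, hikeWeight h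

end Hikes

/-! ### Genuine walks and their loop-erasure -/

section Walks

variable {V : Type*}

/-- The set of walks of length `l` from `u` to `v`, given by the list of their `l + 1` vertices. -/
def walks (A : Matrix V V ℂ) (u v : V) (l : ℕ) : Set (List V) :=
  {w | w.IsChain (Edge A) ∧ w.length = l + 1 ∧ w.head? = some u ∧ w.getLast? = some v}

/-- One step of the chronological loop-erasure.  The state consists of the current self-avoiding
path, latest vertex first, and the last loop erased so far (`[]` if there is none).  If the new
vertex `x` is already on the path, the loop formed from `x` back to `x` is erased. -/
def eraseStep [DecidableEq V] (s : List V × List V) (x : V) : List V × List V :=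
  if x ∈ s.1 then
    (s.1.dropWhile (fun y => decide (y ≠ x)), x :: (s.1.takeWhile (fun y => decide (y ≠ x))).reverse)
  else (x :: s.1, s.2)

/-- The self-avoiding path left after the chronological erasure of the loops of a walk. -/
def loopErasure [DecidableEq V] (w : List V) : List V := (w.foldl eraseStep ([], [])).1.reverse

/-- The last loop erased by the chronological loop-erasure of a walk. -/
def lastErasedLoop [DecidableEq V] (w : List V) : Cycle V := ((w.foldl eraseStep ([], [])).2 : Cycle V)

/-- The total weight of a set of walks (its cardinality, if the graph is unweighted). -/
def totalWalkWeight (A : Matrix V V ℂ) (S : Set (List V)) : ℂ := ∑ᶠ w ∈ S, walkWeight A w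

end Walks

/-! ### Analytic quantities -/

/-- `lam` is the unique dominant eigenvalue: it has algebraic multiplicity one, and every other
eigenvalue has strictly smaller modulus. -/
def IsUniqueDominant {V : Type*} [Fintype V] [DecidableEq V] (A : Matrix V V ℂ) (lam : ℂ) : Prop :=
  A.charpoly.rootMultiplicity lam = 1 ∧
    ∀ μ : ℂ, A.charpoly.IsRoot μ → μ ≠ lam → ‖μ‖ < ‖lam‖

/-- The ordinary generating function `ζ(z) = ∑ₕ z ^ ℓ(h)` of the (weighted) hikes. -/
def zeta {V : Type*} (A : Matrix V V ℂ) : PowerSeries ℂ :=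
  PowerSeries.mk fun l : ℕ => totalWeight (hikesOfLength A l)

/-- `f(n) = [z ^ n] ζ(z / lam)`, which is `0` for negative `n`. -/
def zetaCoeff {V : Type*} (A : Matrix V V ℂ) (lam : ℂ) (n : ℤ) : ℂ :=
  if 0 ≤ n then PowerSeries.coeff n.toNat (PowerSeries.rescale lam⁻¹ (zeta A)) else 0

/-- The backward difference operator `∇[F](x) = F(x) - F(x - 1)`. -/
def backwardDiff (F : ℤ → ℂ) : ℤ → ℂ := fun x => F x - F (x - 1)

open Classical in
/-- `det (I - z A_{G∖U})`, where `A_{G∖U}` is the adjacency matrix of the subgraph induced by the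
complement of the set of vertices `U`. -/
def detOff {V : Type*} [Fintype V] (A : Matrix V V ℂ) (U : Set V) (z : ℂ) : ℂ :=
  (1 - z • A.submatrix (Subtype.val : {v : V // v ∉ U} → V)
    (Subtype.val : {v : V // v ∉ U} → V)).det

/-- `Sᵤ(l) / |Hₗ|`, where `|Hₗ|` is the number (weight) of the hikes of length `l` and `Sᵤ(l)` that
of the hikes of length `l - m` without right prime divisor in `G∖U`. -/
def sieveRatio {V : Type*} (A : Matrix V V ℂ) (U : Set V) (m l : ℕ) : ℂ :=
  totalWeight (sievedHikes A ((l : ℤ) - m) (primesOff A U)) / totalWeight (hikesOfLength A l)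

/-- `lam ^ (-m) * det (I - A_{G∖U} / lam)`. -/
def mainTerm {V : Type*} [Fintype V] (A : Matrix V V ℂ) (lam : ℂ) (U : Set V) (m : ℕ) : ℂ :=
  (1 / lam ^ m) * detOff A U (1 / lam)

/-- The `k`-th term of the series for the error. -/
def errTerm {V : Type*} [Fintype V] (A : Matrix V V ℂ) (lam : ℂ) (U : Set V) (m l k : ℕ) : ℂ :=
  (1 / lam ^ m) *
    (((-1) ^ k * backwardDiff^[k] (zetaCoeff A lam) ((l : ℤ) - m)
        / (zetaCoeff A lam l * lam ^ k * (k.factorial : ℂ)) - (if k = 0 then 1 else 0))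
      * iteratedDeriv k (detOff A U) (1 / lam))

/-! ### Sanity facts: the sums above are finite, and count if the graph is unweighted -/

section Facts

variable {V : Type*} {A : Matrix V V ℂ}

theorem SimpleCycle.toCycle_injective :
    Function.Injective (SimpleCycle.toCycle : SimpleCycle A → Cycle V) := by
  rintro ⟨a, _, _, _⟩ ⟨b, _, _, _⟩ h
  cases h
  rfl

instance finite_simpleCycle [Finite V] : Finite (SimpleCycle A) := by
  classical
  have := Fintype.ofFinite V
  refine Finite.of_injective
    (fun p : SimpleCycle A => (⟨p.toCycle, p.nodup⟩ : {s : Cycle V // s.Nodup})) ?_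
  intro p q h
  exact SimpleCycle.toCycle_injective (congrArg Subtype.val h)

theorem SimpleCycle.one_le_length (p : SimpleCycle A) : 1 ≤ p.length := by
  obtain ⟨c, h0, h1, h2⟩ := p
  induction c using Quotient.inductionOn' with
  | h l =>
    cases l with
    | nil => exact absurd rfl h0
    | cons a t => exact Nat.succ_le_succ (Nat.zero_le _)

theorem length_le_hikeLength (w : List (SimpleCycle A)) :
    w.length ≤ hikeLength (PresentedMonoid.mk (CommRel A) (FreeMonoid.ofList w)) := by
  induction w with
  | nil => exact Nat.zero_le _
  | cons p w ih =>
    have h : hikeLength (PresentedMonoid.mk (CommRel A) (FreeMonoid.ofList (p :: w)))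
        = p.length + hikeLength (PresentedMonoid.mk (CommRel A) (FreeMonoid.ofList w)) := by
      rw [FreeMonoid.ofList_cons, map_mul]
      simp only [hikeLength, map_mul, toAdd_mul]
      rfl
    rw [h, List.length_cons, Nat.add_comm]
    exact Nat.add_le_add p.one_le_length ih

/-- On a finite graph there are only finitely many hikes of a given length. -/
theorem finite_hikesOfLength [Finite V] (n : ℤ) : (hikesOfLength A n).Finite := by
  refine Set.Finite.subset ((List.finite_length_le (SimpleCycle A) n.toNat).image
    (fun w => PresentedMonoid.mk (CommRel A) (FreeMonoid.ofList w))) ?_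
  intro h hh
  obtain ⟨x, rfl⟩ := PresentedMonoid.surjective_mk h
  refine ⟨FreeMonoid.toList x, ?_, rfl⟩
  have h1 := length_le_hikeLength (FreeMonoid.toList x)
  have h2 : (hikeLength (PresentedMonoid.mk (CommRel A) x) : ℤ) = n := hh
  change (FreeMonoid.toList x).length ≤ n.toNat
  have h3 : FreeMonoid.ofList (FreeMonoid.toList x) = x := rfl
  rw [h3] at h1
  omega

theorem finite_walks [Finite V] (u v : V) (l : ℕ) : (walks A u v l).Finite :=
  (List.finite_length_eq V (l + 1)).subset fun _ hw => hw.2.1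

/-- In an unweighted graph every walk has weight one. -/
theorem walkWeight_eq_one (hA : ∀ i j, A i j = 0 ∨ A i j = 1) (w : List V)
    (hw : w.IsChain (Edge A)) : walkWeight A w = 1 := by
  induction w with
  | nil => simp [walkWeight]
  | cons a t ih =>
    cases t with
    | nil => simp [walkWeight]
    | cons b t =>
      rw [List.isChain_cons_cons] at hw
      have h1 : A a b = 1 := (hA a b).resolve_left hw.1
      have h2 := ih hw.2
      simp only [walkWeight, List.tail_cons] at h2
      simp [walkWeight, h1, h2]

/-- In an unweighted graph every simple cycle has weight one. -/
theorem SimpleCycle.weight_eq_one (hA : ∀ i j, A i j = 0 ∨ A i j = 1) (p : SimpleCycle A) :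
    p.weight = 1 := by
  obtain ⟨c, h0, h1, h2⟩ := p
  induction c using Quotient.inductionOn' with
  | h l =>
    cases l with
    | nil => exact absurd rfl h0
    | cons a t =>
      have h3 := walkWeight_eq_one hA _ ((Cycle.chain_coe_cons (Edge A) a t).1 h2)
      have key : ∀ (x b : V) (s : List V), List.zipWith (fun i j => A i j) (x :: (s ++ [b])) (s ++ [b])
          = List.zipWith (fun i j => A i j) (x :: s) (s ++ [b]) := by
        intro x b s
        induction s generalizing x with
        | nil => simp
        | cons y s ih => simpa using ih y
      change (List.zipWith (fun i j => A i j) (a :: t) ((a :: t).rotate 1)).prod = 1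
      have h4 : (a :: t).rotate 1 = t ++ [a] := by simp
      rw [h4, ← key]
      exact h3

/-- In an unweighted graph the total weight of the hikes of given length in a set is their number. -/
theorem totalWeight_eq_ncard [Finite V] (hA : ∀ i j, A i j = 0 ∨ A i j = 1) (n : ℤ)
    (S : Set (Hike A)) (hS : S ⊆ hikesOfLength A n) : totalWeight S = (S.ncard : ℂ) := by
  have h1 : ∀ h : Hike A, hikeWeight h = 1 := by
    intro h
    obtain ⟨x, rfl⟩ := PresentedMonoid.surjective_mk h
    induction x using FreeMonoid.inductionOn with
    | one => simp [hikeWeight]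
    | of p => exact p.weight_eq_one hA
    | mul x y hx hy =>
      simp only [hikeWeight, map_mul] at hx hy ⊢
      rw [hx, hy, one_mul]
  have hf : S.Finite := (finite_hikesOfLength n).subset hS
  simp only [totalWeight, h1]
  rw [finsum_mem_eq_finite_toFinset_sum _ hf, Set.ncard_eq_toFinset_card S hf]
  simp

end Facts

end

end HikeSieve

/-! Two families indexed by vertex sets `U` obey one recursion. On the side of hikes, enlarging `U`
by a vertex `x` allows at most one new right prime divisor: a prime `p` off `U` through `x`.
Dividing it out leaves a hike sieved for `U ∪ p.verts` (`sieved_insert`). On the side of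
determinants, expanding `det (1 - X A_{G∖U})` along row `x` gives the same sum over simple cycles
through `x`, with `X ^ k` in place of a delay by `k` (`revPoly_insert_eq_sum`). For `U = Set.univ`
one has all hikes and the determinant `1`. Hence `sieved A U` is the determinant, evaluated at the
shift operator, applied to the sequence of all hikes (`sieved_eq_aeval`).

For `U = ∅` only the trivial hike survives, so `ζ(z) det (1 - zA) = 1`. As `lam` is simple and
dominant, `(1 - z) ζ(z / lam)` has absolutely summable coefficients with nonzero sum; their partial
sums are `f`, which is therefore bounded with a nonzero limit. Expanding the determinant in powers
of `X` gives the limit of the ratio. Expanding it in powers of `X - 1 / lam` gives the exact error,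
because the shift minus `1 / lam` acts on `lam ^ n f(n)` as a multiple of the backward difference.

Walks are compared with hikes without a bijection: conditioning on the last step, the weight of the
walks with a given loop-erasure satisfies the sieve recursion again (`erasureWeight_eq`). A closing
edge then turns loop-erasures into last erased loops. -/

namespace HikeSieve

noncomputable section

/-! ### Divisibility in the monoid of hikes, through its projections to free monoids. -/

section TraceMonoid

variable {V : Type*} {A : Matrix V V ℂ}

theorem SimpleCycle.verts_nonempty (p : SimpleCycle A) : p.verts.Nonempty := by
  obtain ⟨c, h0, h1, h2⟩ := p
  induction c using Quotient.inductionOn' with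
  | h l =>
    cases l with
    | nil => exact absurd rfl h0
    | cons a t => exact ⟨a, List.mem_cons_self⟩

theorem prime_mul_comm {p q : SimpleCycle A} (h : Disjoint p.verts q.verts) :
    prime p * prime q = prime q * prime p :=
  PresentedMonoid.mk_eq_mk_of_rel (rels := CommRel A)
    (x := FreeMonoid.of p * FreeMonoid.of q) (y := FreeMonoid.of q * FreeMonoid.of p)
    ⟨p, q, h, rfl, rfl⟩

/-- Every property of hikes that holds for `1` and is stable under right multiplication by primes
holds for all hikes. -/
theorem Hike.induction_right {motive : Hike A → Prop} (one : motive 1)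
    (mul_prime : ∀ g p, motive g → motive (g * prime p)) (h : Hike A) : motive h := by
  obtain ⟨x, rfl⟩ := PresentedMonoid.surjective_mk h
  suffices ∀ w : List (SimpleCycle A),
      motive (PresentedMonoid.mk (CommRel A) (FreeMonoid.ofList w)) from this (FreeMonoid.toList x)
  intro w
  induction w using List.reverseRecOn with
  | nil => exact one
  | append_singleton w p ih =>
    rw [FreeMonoid.ofList_append, map_mul]
    exact mul_prime _ p ih

open Classical in
/-- The projection of hikes to words on the primes through the vertex `v`. -/
def proj (A : Matrix V V ℂ) (v : V) : Hike A →* FreeMonoid (SimpleCycle A) :=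
  PresentedMonoid.lift (fun p => if v ∈ p.verts then FreeMonoid.of p else 1) (by
    rintro _ _ ⟨p, q, hd, rfl, rfl⟩
    simp only [map_mul, FreeMonoid.lift_eval_of]
    by_cases hp : v ∈ p.verts
    · have hq : v ∉ q.verts := fun hq => Set.disjoint_left.1 hd hp hq
      simp [hp, hq]
    · simp [hp])

theorem proj_prime_of_mem {v : V} {p : SimpleCycle A} (h : v ∈ p.verts) :
    proj A v (prime p) = FreeMonoid.of p := by
  classical
  exact if_pos h

theorem proj_prime_of_notMem {v : V} {p : SimpleCycle A} (h : v ∉ p.verts) :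
    proj A v (prime p) = 1 := by
  classical
  exact if_neg h

theorem freeMonoid_mul_of_inj {α : Type*} {x y : FreeMonoid α} {a b : α}
    (h : x * FreeMonoid.of a = y * FreeMonoid.of b) : x = y ∧ a = b := by
  have h' : FreeMonoid.toList x ++ [a] = FreeMonoid.toList y ++ [b] := congrArg FreeMonoid.toList h
  obtain ⟨h1, h2⟩ := List.append_inj' h' rfl
  exact ⟨FreeMonoid.toList.injective h1, by simpa using h2⟩

theorem freeMonoid_one_ne_mul_of {α : Type*} (x : FreeMonoid α) (a : α) :
    (1 : FreeMonoid α) ≠ x * FreeMonoid.of a := by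
  intro h
  have h' : ([] : List α) = FreeMonoid.toList x ++ [a] := congrArg FreeMonoid.toList h
  simp at h'

/-- A prime right-divides a hike as soon as it does so in all projections to its vertices. -/
theorem rightDvd_of_proj {q : SimpleCycle A} {h : Hike A}
    (hq : ∀ v ∈ q.verts, ∃ x, proj A v h = x * FreeMonoid.of q) : RightDvd q h := by
  induction h using Hike.induction_right with
  | one =>
    obtain ⟨v, hv⟩ := q.verts_nonempty
    obtain ⟨x, hx⟩ := hq v hv
    rw [map_one] at hx
    exact absurd hx (freeMonoid_one_ne_mul_of _ _)
  | mul_prime g p ih =>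
    by_cases hpq : p = q
    · exact ⟨g, by rw [hpq]⟩
    -- At a common vertex the projected word would end in both `p` and `q`. Being disjoint from `q`,
    -- the factor `p` is invisible at the vertices of `q`, so induction applies to `g`, and `q`
    -- commutes past `p`.
    · have hd : Disjoint p.verts q.verts := by
        rw [Set.disjoint_left]
        intro v hp hv
        obtain ⟨x, hx⟩ := hq v hv
        rw [map_mul, proj_prime_of_mem hp] at hx
        exact hpq (freeMonoid_mul_of_inj hx).2
      obtain ⟨g', rfl⟩ := ih (by
        intro v hv
        obtain ⟨x, hx⟩ := hq v hv
        rw [map_mul, proj_prime_of_notMem (fun hp => Set.disjoint_left.1 hd hp hv), mul_one] at hx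
        exact ⟨x, hx⟩)
      exact ⟨g' * prime p, by rw [mul_assoc, mul_assoc, prime_mul_comm hd]⟩

/-- A hike is determined by its projections. -/
theorem proj_injective {h h' : Hike A} (hp : ∀ v, proj A v h = proj A v h') : h = h' := by
  induction h using Hike.induction_right generalizing h' with
  | one =>
    induction h' using Hike.induction_right with
    | one => rfl
    | mul_prime g p _ =>
      obtain ⟨v, hv⟩ := p.verts_nonempty
      have := hp v
      rw [map_one, map_mul, proj_prime_of_mem hv] at this
      exact absurd this (freeMonoid_one_ne_mul_of _ _)
  | mul_prime g p ih =>
    obtain ⟨g', rfl⟩ := rightDvd_of_proj (q := p) (h := h') fun v hv => ⟨proj A v g, by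
      rw [← hp v, map_mul, proj_prime_of_mem hv]⟩
    rw [ih (h' := g') fun v => ?_]
    have := hp v
    rw [map_mul, map_mul] at this
    exact mul_right_cancel this

theorem Hike.mul_prime_injective (p : SimpleCycle A) :
    Function.Injective (fun g : Hike A => g * prime p) := by
  intro g g' h
  refine proj_injective fun v => ?_
  have := congrArg (proj A v) h
  simp only [map_mul] at this
  exact mul_right_cancel this

/-- At a shared vertex the projection has a single last letter, which forces disjointness; disjoint
primes then commute past each other. -/
theorem rightDvd_mul_prime_iff {p q : SimpleCycle A} (hpq : q ≠ p) (g : Hike A) :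
    RightDvd q (g * prime p) ↔ Disjoint q.verts p.verts ∧ RightDvd q g := by
  constructor
  · rintro ⟨g', hg⟩
    have hd : Disjoint q.verts p.verts := by
      rw [Set.disjoint_left]
      intro v hq hp
      have := congrArg (proj A v) hg
      rw [map_mul, map_mul, proj_prime_of_mem hp, proj_prime_of_mem hq] at this
      exact hpq (freeMonoid_mul_of_inj this).2.symm
    refine ⟨hd, rightDvd_of_proj fun v hv => ⟨proj A v g', ?_⟩⟩
    have := congrArg (proj A v) hg
    rwa [map_mul, map_mul, proj_prime_of_mem hv,
      proj_prime_of_notMem (Set.disjoint_left.1 hd hv), mul_one] at this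
  · rintro ⟨hd, g', rfl⟩
    exact ⟨g' * prime p, by rw [mul_assoc, mul_assoc, prime_mul_comm hd]⟩

theorem hikeLength_mul_prime (g : Hike A) (p : SimpleCycle A) :
    hikeLength (g * prime p) = hikeLength g + p.length := by
  simp only [hikeLength, map_mul, toAdd_mul]
  rfl

theorem hikeWeight_mul_prime (g : Hike A) (p : SimpleCycle A) :
    hikeWeight (g * prime p) = p.weight * hikeWeight g := by
  simp only [hikeWeight, map_mul]
  exact mul_comm _ _

theorem totalWeight_image_mul_prime (p : SimpleCycle A) (S : Set (Hike A)) :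
    totalWeight ((fun g => g * prime p) '' S) = p.weight * totalWeight S := by
  rw [totalWeight, finsum_mem_image (Hike.mul_prime_injective p).injOn]
  simp only [hikeWeight_mul_prime, totalWeight]
  simp_rw [finsum_mem_def, mul_finsum]
  refine finsum_congr fun g => ?_
  by_cases hg : g ∈ S <;> simp [hg]

/-- Two primes through a common vertex that right-divide the same hike are equal. -/
theorem eq_of_rightDvd_of_mem {p q : SimpleCycle A} {h : Hike A} (hp : RightDvd p h)
    (hq : RightDvd q h) {v : V} (hvp : v ∈ p.verts) (hvq : v ∈ q.verts) : q = p := by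
  obtain ⟨g, rfl⟩ := hp
  by_contra hne
  exact Set.disjoint_left.1 ((rightDvd_mul_prime_iff hne g).1 hq).1 hvq hvp

end TraceMonoid

/-! ### The sieve on right prime divisors and its recursion. -/

section Sieve

variable {V : Type*} {A : Matrix V V ℂ}

/-- The total weight of the hikes of length `n` without right prime divisor off `U`. -/
def sieved (A : Matrix V V ℂ) (U : Set V) (n : ℤ) : ℂ :=
  totalWeight (sievedHikes A n (primesOff A U))

theorem mul_prime_mem_hikesOfLength {p : SimpleCycle A} {g : Hike A} {n : ℤ} :
    g * prime p ∈ hikesOfLength A n ↔ g ∈ hikesOfLength A (n - p.length) := by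
  simp only [hikesOfLength, Set.mem_ofPred_eq, hikeLength_mul_prime]
  push_cast
  exact eq_sub_iff_add_eq.symm

/-- Once `p` is split off, any other right divisor of `g * prime p` is a right divisor of `g`
disjoint from `p`, so uniqueness of `p` is exactly a sieve condition on `g`. -/
theorem walkHikes_eq_image (p : SimpleCycle A) (n : ℤ) :
    walkHikes A n p = (fun g => g * prime p) ''
      sievedHikes A (n - p.length) (primesOff A p.verts) := by
  ext h
  constructor
  · rintro ⟨hn, hq⟩
    obtain ⟨g, rfl⟩ := (hq p).2 rfl
    refine ⟨g, ⟨mul_prime_mem_hikesOfLength.1 hn, fun q hqU hqg => ?_⟩, rfl⟩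
    have hd : Disjoint q.verts p.verts := Set.disjoint_left.2 fun _ h => hqU h
    obtain ⟨v, hv⟩ := q.verts_nonempty
    have hne : q ≠ p := by
      rintro rfl
      exact hqU hv hv
    exact hne ((hq q).1 ((rightDvd_mul_prime_iff hne g).2 ⟨hd, hqg⟩))
  · rintro ⟨g, ⟨hn, hq⟩, rfl⟩
    refine ⟨mul_prime_mem_hikesOfLength.2 hn, fun q => ⟨fun h => ?_, ?_⟩⟩
    · by_contra hne
      obtain ⟨hd, hqg⟩ := (rightDvd_mul_prime_iff hne g).1 h
      exact hq q (fun _ hv => Set.disjoint_left.1 hd hv) hqg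
    · rintro rfl
      exact ⟨g, rfl⟩

theorem totalWeight_walkHikes (p : SimpleCycle A) (n : ℤ) :
    totalWeight (walkHikes A n p) = p.weight * sieved A p.verts (n - p.length) := by
  rw [walkHikes_eq_image, totalWeight_image_mul_prime, sieved]

/-- A right divisor `p` off `U` is tolerated by `insert x U` only if it passes through `x`. The
other right divisors of the product are those of the quotient disjoint from `p`, whence the sieve
for `U ∪ p.verts`. Two right divisors through `x` coincide, so the union is disjoint. -/
theorem sievedHikes_insert {U : Set V} {x : V} (n : ℤ) :
    sievedHikes A n (primesOff A (insert x U)) = sievedHikes A n (primesOff A U) ∪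
      ⋃ p ∈ {p : SimpleCycle A | x ∈ p.verts ∧ p ∈ primesOff A U}, (fun g => g * prime p) ''
        sievedHikes A (n - p.length) (primesOff A (U ∪ p.verts)) := by
  ext h
  simp only [Set.mem_union, Set.mem_iUnion, exists_prop]
  constructor
  · rintro ⟨hn, hh⟩
    by_cases hU : ∀ q ∈ primesOff A U, ¬ RightDvd q h
    · exact Or.inl ⟨hn, hU⟩
    · push Not at hU
      obtain ⟨p, hpU, hp⟩ := hU
      have hx : x ∈ p.verts := by
        by_contra hx
        refine hh p (fun v hv => ?_) hp
        rintro (rfl | hvU)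
        · exact hx hv
        · exact hpU hv hvU
      obtain ⟨g, rfl⟩ := hp
      refine Or.inr ⟨p, ⟨hx, hpU⟩, g, ⟨mul_prime_mem_hikesOfLength.1 hn, fun q hq hqg => ?_⟩, rfl⟩
      have hd : Disjoint q.verts p.verts := Set.disjoint_left.2 fun _ h h' => hq h (Or.inr h')
      have hne : q ≠ p := by
        rintro rfl
        exact hq hx (Or.inr hx)
      refine hh q (fun v hv => ?_) ((rightDvd_mul_prime_iff hne g).2 ⟨hd, hqg⟩)
      rintro (rfl | hvU)
      · exact hq hv (Or.inr hx)
      · exact hq hv (Or.inl hvU)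
  · rintro (⟨hn, hh⟩ | ⟨p, ⟨hx, hpU⟩, g, ⟨hn, hh⟩, rfl⟩)
    · exact ⟨hn, fun q hq => hh q fun v hv hvU => hq hv (Or.inr hvU)⟩
    · refine ⟨mul_prime_mem_hikesOfLength.2 hn, fun q hq hqg => ?_⟩
      have hne : q ≠ p := by
        rintro rfl
        exact hq hx (Or.inl rfl)
      obtain ⟨hd, hqg⟩ := (rightDvd_mul_prime_iff hne g).1 hqg
      refine hh q (fun v hv => ?_) hqg
      rintro (hvU | hvp)
      · exact hq hv (Or.inr hvU)
      · exact Set.disjoint_left.1 hd hv hvp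

theorem finite_sievedHikes [Finite V] (n : ℤ) (P : Set (SimpleCycle A)) :
    (sievedHikes A n P).Finite :=
  (finite_hikesOfLength n).subset fun _ h => h.1

theorem sieved_insert [Finite V] (U : Set V) (x : V) (n : ℤ) :
    sieved A (insert x U) n = sieved A U n +
      ∑ᶠ p ∈ {p : SimpleCycle A | x ∈ p.verts ∧ p ∈ primesOff A U},
        p.weight * sieved A (U ∪ p.verts) (n - p.length) := by
  have hfin : ∀ p : SimpleCycle A, ((fun g => g * prime p) ''
      sievedHikes A (n - p.length) (primesOff A (U ∪ p.verts))).Finite :=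
    fun p => (finite_sievedHikes _ _).image _
  have hP : {p : SimpleCycle A | x ∈ p.verts ∧ p ∈ primesOff A U}.Finite := Set.toFinite _
  rw [sieved, totalWeight, sievedHikes_insert, finsum_mem_union]
  · rw [finsum_mem_biUnion _ hP fun p _ => hfin p]
    · congr 1
      refine finsum_mem_congr rfl fun p _ => ?_
      exact totalWeight_image_mul_prime p _
    · intro p hp q hq hne
      refine Set.disjoint_left.2 ?_
      rintro _ ⟨g, -, rfl⟩ ⟨g', -, hg⟩
      exact hne (eq_of_rightDvd_of_mem ⟨g', hg.symm⟩ ⟨g, rfl⟩ hq.1 hp.1)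
  · refine Set.disjoint_left.2 fun h hh h' => ?_
    simp only [Set.mem_iUnion, exists_prop] at h'
    obtain ⟨p, ⟨-, hp⟩, g, -, rfl⟩ := h'
    exact hh.2 p hp ⟨g, rfl⟩
  · exact finite_sievedHikes _ _
  · exact hP.biUnion fun p _ => hfin p

theorem sieved_univ (n : ℤ) : sieved A Set.univ n = totalWeight (hikesOfLength A n) := by
  rw [sieved]
  congr 1
  ext h
  refine ⟨fun h => h.1, fun hh => ⟨hh, fun q hq => ?_⟩⟩
  obtain ⟨v, hv⟩ := q.verts_nonempty
  exact absurd trivial (hq hv)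

theorem sieved_of_neg (U : Set V) {n : ℤ} (hn : n < 0) : sieved A U n = 0 := by
  have : sievedHikes A n (primesOff A U) = ∅ := by
    refine Set.eq_empty_of_forall_notMem fun h hh => ?_
    have : (hikeLength h : ℤ) = n := hh.1
    omega
  rw [sieved, this, totalWeight, finsum_mem_empty]

theorem eq_one_of_hikeLength_eq_zero {h : Hike A} (hh : hikeLength h = 0) : h = 1 := by
  induction h using Hike.induction_right with
  | one => rfl
  | mul_prime g p _ =>
    rw [hikeLength_mul_prime] at hh
    have := p.one_le_length
    omega

theorem hikeLength_one : hikeLength (1 : Hike A) = 0 := by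
  simp [hikeLength]

theorem not_rightDvd_one (q : SimpleCycle A) : ¬ RightDvd q (1 : Hike A) := by
  rintro ⟨g, hg⟩
  have := congrArg hikeLength hg
  rw [hikeLength_mul_prime, hikeLength_one] at this
  have := q.one_le_length
  omega

theorem sieved_zero (U : Set V) : sieved A U 0 = 1 := by
  have : sievedHikes A 0 (primesOff A U) = {1} := by
    ext h
    simp only [Set.mem_singleton_iff]
    constructor
    · rintro ⟨hn, -⟩
      exact eq_one_of_hikeLength_eq_zero (by exact_mod_cast (show (hikeLength h : ℤ) = 0 from hn))
    · rintro rfl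
      exact ⟨by simp [hikesOfLength, hikeLength_one], fun q _ => not_rightDvd_one q⟩
  rw [sieved, this, totalWeight, finsum_mem_singleton, hikeWeight, map_one]

/-- Every prime is forbidden here, and a nontrivial hike has a last factor. -/
theorem sieved_empty {n : ℤ} (hn : n ≠ 0) : sieved A ∅ n = 0 := by
  have : sievedHikes A n (primesOff A ∅) = ∅ := by
    refine Set.eq_empty_of_forall_notMem fun h hh => ?_
    induction h using Hike.induction_right with
    | one =>
      have : (hikeLength (1 : Hike A) : ℤ) = n := hh.1
      rw [hikeLength_one] at this
      exact hn this.symm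
    | mul_prime g p _ => exact hh.2 p (fun _ _ h => h) ⟨g, rfl⟩
  rw [sieved, this, totalWeight, finsum_mem_empty]

end Sieve

/-! ### Repetition-free vertex lists, and weights of walks and cycles. -/

section Lists

variable {V : Type*}

/-- The vertices outside `U`. -/
def outside [Finite V] (U : Set V) : Finset V := (Set.toFinite Uᶜ).toFinset

@[simp]
theorem mem_outside [Finite V] {U : Set V} {x : V} : x ∈ outside U ↔ x ∉ U := by
  simp [outside]

theorem card_outside_insert [Finite V] {U : Set V} {x : V} (hx : x ∉ U) :
    (outside U).card = (outside (insert x U)).card + 1 := by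
  classical
  have h : outside (insert x U) = (outside U).erase x := by
    ext y
    simp [not_or]
  rw [h, Finset.card_erase_add_one (mem_outside.2 hx)]

theorem finite_freshLists [Finite V] (U : Set V) :
    {l : List V | l.Nodup ∧ ∀ y ∈ l, y ∉ U}.Finite := by
  classical
  have := Fintype.ofFinite V
  exact (Set.toFinite (Set.range (Subtype.val : {l : List V // l.Nodup} → List V))).subset
    fun l hl => ⟨⟨l, hl.1⟩, rfl⟩

/-- The lists without repetition of vertices outside `U`. -/
def freshLists [Finite V] (U : Set V) : Finset (List V) := (finite_freshLists U).toFinset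

@[simp]
theorem mem_freshLists [Finite V] {U : Set V} {l : List V} :
    l ∈ freshLists U ↔ l.Nodup ∧ ∀ y ∈ l, y ∉ U := by
  simp [freshLists]

theorem sum_freshLists [Finite V] {M : Type*} [AddCommMonoid M] (U : Set V) (φ : List V → M) :
    ∑ l ∈ freshLists U, φ l =
      φ [] + ∑ j ∈ outside U, ∑ l ∈ freshLists (insert j U), φ (j :: l) := by
  classical
  have h : freshLists U = insert [] ((outside U).biUnion fun j =>
      (freshLists (insert j U)).image (List.cons j)) := by
    ext l
    cases l with
    | nil => simp
    | cons j l =>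
      simp only [mem_freshLists, List.nodup_cons, List.forall_mem_cons, Finset.mem_insert,
        reduceCtorEq, false_or, Finset.mem_biUnion, mem_outside, Finset.mem_image,
        Set.mem_insert_iff, List.cons.injEq, not_or]
      constructor
      · rintro ⟨⟨h1, h2⟩, h3, h4⟩
        exact ⟨j, h3, l, ⟨h2, fun y hy => ⟨fun h => h1 (h ▸ hy), h4 y hy⟩⟩, rfl, rfl⟩
      · rintro ⟨_, h3, _, ⟨h2, h4⟩, rfl, rfl⟩
        exact ⟨⟨fun h => (h4 _ h).1 rfl, h2⟩, h3, fun y hy => (h4 y hy).2⟩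
  rw [h, Finset.sum_insert (by simp), Finset.sum_biUnion]
  · congr 1
    refine Finset.sum_congr rfl fun j _ => ?_
    rw [Finset.sum_image fun _ _ _ _ h => (List.cons.inj h).2]
  · intro i _ j _ hij
    rw [Function.onFun, Finset.disjoint_left]
    intro l hl hl'
    obtain ⟨a, -, rfl⟩ := Finset.mem_image.1 hl
    obtain ⟨b, -, hb⟩ := Finset.mem_image.1 hl'
    exact hij (List.cons.inj hb).1.symm

@[simp]
theorem walkWeight_singleton (A : Matrix V V ℂ) (a : V) : walkWeight A [a] = 1 := by
  simp [walkWeight]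

@[simp]
theorem walkWeight_cons_cons (A : Matrix V V ℂ) (a b : V) (t : List V) :
    walkWeight A (a :: b :: t) = A a b * walkWeight A (b :: t) := by
  simp [walkWeight]

theorem walkWeight_append_pair (A : Matrix V V ℂ) (l : List V) (a b : V) :
    walkWeight A (l ++ [a, b]) = walkWeight A (l ++ [a]) * A a b := by
  induction l with
  | nil => simp
  | cons c l ih =>
    cases l with
    | nil => simp
    | cons d l =>
      simp only [List.cons_append, walkWeight_cons_cons] at ih ⊢
      rw [ih, mul_assoc]

theorem walkWeight_ne_zero_iff (A : Matrix V V ℂ) (w : List V) :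
    walkWeight A w ≠ 0 ↔ w.IsChain (Edge A) := by
  induction w with
  | nil => simp [walkWeight]
  | cons a t ih =>
    cases t with
    | nil => simp
    | cons b t => simp [Edge, ← ih]

theorem cycleWeight_cons (A : Matrix V V ℂ) (a : V) (t : List V) :
    cycleWeight A ((a :: t : List V) : Cycle V) = walkWeight A (a :: (t ++ [a])) := by
  have key : ∀ (x b : V) (s : List V),
      List.zipWith (fun i j => A i j) (x :: (s ++ [b])) (s ++ [b])
        = List.zipWith (fun i j => A i j) (x :: s) (s ++ [b]) := by
    intro x b s
    induction s generalizing x with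
    | nil => simp
    | cons y s ih => simpa using ih y
  change (List.zipWith (fun i j => A i j) (a :: t) ((a :: t).rotate 1)).prod = _
  rw [walkWeight, List.tail_cons, key]
  simp

theorem eq_of_cons_isRotated_cons {a : V} {l l' : List V} (hl : (a :: l).Nodup)
    (h : (a :: l) ~r (a :: l')) : l = l' := by
  obtain ⟨k, hk, hkl⟩ := List.isRotated_iff_mod.1 h
  rcases hk.eq_or_lt with rfl | hk
  · rw [List.rotate_length] at hkl
    exact (List.cons.inj hkl).2
  · have h1 := List.head?_rotate hk
    rw [hkl, List.head?_cons, List.getElem?_eq_getElem hk, Option.some_inj] at h1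
    have h2 : k = 0 := (hl.getElem_inj_iff (hi := hk) (hj := by simp)).1 (by rw [← h1]; rfl)
    subst h2
    rw [List.rotate_zero] at hkl
    exact (List.cons.inj hkl).2

/-- The list of the vertices of a cycle, starting from a given one. -/
theorem exists_eq_coe_cons {c : Cycle V} {x : V} (hx : x ∈ c) :
    ∃ l : List V, c = ((x :: l : List V) : Cycle V) := by
  induction c using Quotient.inductionOn' with
  | h l =>
    obtain ⟨a, b, rfl⟩ := List.append_of_mem (show x ∈ l from hx)
    exact ⟨b ++ a, Cycle.coe_eq_coe.2 (by simpa using List.isRotated_append (l := a) (l' := x :: b))⟩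

end Lists

/-! ### The sieve recursion as a sum over vertex lists. -/

section Recursion

variable {V : Type*} {A : Matrix V V ℂ}

/-- A prime through `x` is cut open at `x`, which removes the rotation ambiguity. Lists using a
non-edge define no prime but have weight zero, so only nonzero terms are matched. -/
theorem sum_primes_through [Finite V] {U : Set V} {x : V} (hx : x ∉ U) (φ : Set V → ℕ → ℂ) :
    ∑ᶠ p ∈ {p : SimpleCycle A | x ∈ p.verts ∧ p ∈ primesOff A U},
        p.weight * φ (U ∪ p.verts) p.length =
      ∑ l ∈ freshLists (insert x U),
        walkWeight A (x :: (l ++ [x])) * φ (insert x U ∪ {v | v ∈ l}) (l.length + 1) := by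
  have hP : {p : SimpleCycle A | x ∈ p.verts ∧ p ∈ primesOff A U}.Finite := Set.toFinite _
  rw [finsum_mem_eq_finite_toFinset_sum _ hP]
  have hnd : ∀ l ∈ freshLists (insert x U), (x :: l).Nodup := by
    intro l hl
    rw [mem_freshLists] at hl
    exact List.nodup_cons.2 ⟨fun h => hl.2 x h (Or.inl rfl), hl.1⟩
  refine (Finset.sum_bij_ne_zero
    (fun l hl h => (⟨((x :: l : List V) : Cycle V), by simp, Cycle.nodup_coe_iff.2 (hnd l hl),
      (Cycle.chain_coe_cons (Edge A) x l).2
        ((walkWeight_ne_zero_iff A _).1 (left_ne_zero_of_mul h))⟩ : SimpleCycle A))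
    ?_ ?_ ?_ ?_).symm
  · intro l hl h
    rw [Set.Finite.mem_toFinset]
    refine ⟨List.mem_cons_self, fun v hv hvU => ?_⟩
    rcases List.mem_cons.1 (show v ∈ x :: l from hv) with rfl | hv
    · exact hx hvU
    · exact (mem_freshLists.1 hl).2 v hv (Or.inr hvU)
  · intro l hl _ l' _ _ h
    exact eq_of_cons_isRotated_cons (hnd l hl)
      (Cycle.coe_eq_coe.1 (congrArg SimpleCycle.toCycle h))
  · rintro ⟨c, h0, h1, h2⟩ hp hne
    obtain ⟨hxc, hU⟩ := (Set.Finite.mem_toFinset _).1 hp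
    obtain ⟨l, rfl⟩ := exists_eq_coe_cons (show x ∈ c from hxc)
    have hl := Cycle.nodup_coe_iff.1 h1
    rw [List.nodup_cons] at hl
    refine ⟨l, mem_freshLists.2 ⟨hl.2, fun y hy => ?_⟩, ?_, rfl⟩
    · rintro (rfl | hyU)
      · exact hl.1 hy
      · exact hU (show y ∈ x :: l from List.mem_cons_of_mem _ hy) hyU
    · convert hne using 2
      · exact (cycleWeight_cons A x l).symm
      · congr 1
        ext v
        simp [SimpleCycle.verts, or_assoc, or_left_comm]
  · intro l hl h
    congr 1
    · exact (cycleWeight_cons A x l).symm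
    · congr 1
      ext v
      simp [SimpleCycle.verts, or_assoc, or_left_comm]

theorem sieved_insert_eq_sum [Finite V] {U : Set V} {x : V} (hx : x ∉ U) (n : ℤ) :
    sieved A (insert x U) n = sieved A U n +
      ∑ l ∈ freshLists (insert x U), walkWeight A (x :: (l ++ [x])) *
        sieved A (insert x U ∪ {v | v ∈ l}) (n - (l.length + 1 : ℕ)) := by
  rw [sieved_insert, sum_primes_through hx fun W k => sieved A W (n - k)]

end Recursion

/-! ### The same recursion for `det (1 - X A_{G∖U})`. -/

section Determinant

open Polynomial Matrix

variable {V : Type*} [DecidableEq V] (A : Matrix V V ℂ)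

open Classical in
/-- The matrix `1 - X A` with the rows in `U` replaced by those of the identity matrix. -/
def revMatrix (U : Set V) : Matrix V V ℂ[X] :=
  fun i => if i ∈ U then (Pi.single i 1 : V → ℂ[X])
    else (Pi.single i 1 : V → ℂ[X]) + (-X : ℂ[X]) • fun j => C (A i j)

theorem revMatrix_of_mem {U : Set V} {i : V} (h : i ∈ U) :
    revMatrix A U i = (Pi.single i 1 : V → ℂ[X]) := by
  simp [revMatrix, h]

theorem revMatrix_of_notMem {U : Set V} {i : V} (h : i ∉ U) :
    revMatrix A U i = (Pi.single i 1 : V → ℂ[X]) + (-X : ℂ[X]) • fun j => C (A i j) := by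
  simp [revMatrix, h]

theorem revMatrix_insert_of_ne {U : Set V} {i j : V} (h : i ≠ j) :
    revMatrix A (insert j U) i = revMatrix A U i := by
  by_cases hi : i ∈ U
  · rw [revMatrix_of_mem A hi, revMatrix_of_mem A (Or.inr hi)]
  · rw [revMatrix_of_notMem A hi, revMatrix_of_notMem A (by simp [h, hi])]

variable [Fintype V]

/-- The polynomial `det (1 - X A_{G∖U})`. -/
def revPoly (U : Set V) : ℂ[X] := (revMatrix A U).det

/-- The determinant of `revMatrix A U` with row `x` replaced by row `y` of `A`. -/
def revMinor (U : Set V) (x y : V) : ℂ[X] :=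
  ((revMatrix A U).updateRow x fun j => C (A y j)).det

/-- Linearity in row `x`: its identity part amounts to putting `x` into `U`. -/
theorem revPoly_eq_sub_revMinor {U : Set V} {x : V} (hx : x ∉ U) :
    revPoly A U = revPoly A (insert x U) - X * revMinor A (insert x U) x x := by
  have h : revMatrix A U = (revMatrix A (insert x U)).updateRow x
      (Pi.single x 1 + (-X : ℂ[X]) • fun j => C (A x j)) := by
    funext i
    by_cases hi : i = x
    · subst hi
      rw [updateRow_self, revMatrix_of_notMem A hx]
    · rw [updateRow_ne hi, revMatrix_insert_of_ne A hi]
  have h' : (revMatrix A (insert x U)).updateRow x (Pi.single x 1) = revMatrix A (insert x U) := by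
    rw [← revMatrix_of_mem A (Set.mem_insert x U), updateRow_eq_self]
  rw [revPoly, h, det_updateRow_add, det_updateRow_smul, h', revPoly, revMinor]
  ring

/-- Row `j` is `e_j - X A_j`. Its part `e_j` repeats row `x` and contributes nothing; in the other
part, exchanging rows `x` and `j` produces the sign that cancels the one of `-X`. -/
theorem det_revMatrix_updateRow_single {U : Set V} {x j : V} (hx : x ∈ U) (hj : j ∉ U) :
    ((revMatrix A U).updateRow x (Pi.single j 1)).det = X * revMinor A (insert j U) x j := by
  have hne : j ≠ x := fun h => hj (h ▸ hx)
  set N := (revMatrix A U).updateRow x (Pi.single j 1) with hN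
  have h1 : N = N.updateRow j (Pi.single j 1 + (-X : ℂ[X]) • fun k => C (A j k)) := by
    rw [← revMatrix_of_notMem A hj, ← updateRow_ne (M := revMatrix A U) (b := Pi.single j 1) hne,
      ← hN, updateRow_eq_self]
  have h2 : (N.updateRow j (Pi.single j 1)).det = 0 :=
    det_zero_of_row_eq hne (by rw [updateRow_self, updateRow_ne hne.symm, hN, updateRow_self])
  have h3 : N.updateRow j (fun k => C (A j k)) =
      ((revMatrix A (insert j U)).updateRow x fun k => C (A j k)).submatrix (Equiv.swap j x) id := by
    refine funext fun i => ?_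
    change _ = ((revMatrix A (insert j U)).updateRow x fun k => C (A j k)) (Equiv.swap j x i)
    by_cases hij : i = j
    · subst hij
      rw [updateRow_self, Equiv.swap_apply_left, updateRow_self]
    · rw [updateRow_ne hij]
      by_cases hix : i = x
      · subst hix
        rw [hN, updateRow_self, Equiv.swap_apply_right, updateRow_ne hne,
          revMatrix_of_mem A (Or.inl rfl)]
      · rw [hN, updateRow_ne hix, Equiv.swap_apply_of_ne_of_ne hij hix, updateRow_ne hix,
          revMatrix_insert_of_ne A hij]
  rw [h1, det_updateRow_add, det_updateRow_smul, h2, h3, det_permute, Equiv.Perm.sign_swap hne,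
    revMinor]
  simp

/-- Row `y` of `A` is expanded in the basis `e_j`. The term `j = x` restores the identity row, other
`j ∈ U` repeat a row, and `j ∉ U` prolongs the path from `y` by the vertex `j`. -/
theorem revMinor_eq_add_sum {U : Set V} {x : V} (hx : x ∈ U) (y : V) :
    revMinor A U x y = C (A y x) * revPoly A U +
      X * ∑ j ∈ outside U, C (A y j) * revMinor A (insert j U) x j := by
  have h : (fun j => C (A y j)) = ∑ j, C (A y j) • (Pi.single j 1 : V → ℂ[X]) := by
    ext1 k
    simp [Finset.sum_apply, Pi.single_apply]
  have hlin : revMinor A U x y =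
      ∑ j, C (A y j) * ((revMatrix A U).updateRow x (Pi.single j 1)).det := by
    have := map_sum ((detRowAlternating (n := V) (R := ℂ[X])).toMultilinearMap.toLinearMap
      (revMatrix A U) x) (fun j => C (A y j) • (Pi.single j 1 : V → ℂ[X])) Finset.univ
    simp only [map_smul, smul_eq_mul] at this
    rw [revMinor, h]
    exact this
  have hzero : ∀ j, j ∉ insert x (outside U) →
      C (A y j) * ((revMatrix A U).updateRow x (Pi.single j 1)).det = 0 := by
    intro j hj
    rw [Finset.mem_insert, mem_outside, not_or, not_not] at hj
    rw [det_zero_of_row_eq (i := x) (j := j) (Ne.symm hj.1), mul_zero]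
    rw [updateRow_self, updateRow_ne hj.1, revMatrix_of_mem A hj.2]
  rw [hlin, ← Finset.sum_subset (Finset.subset_univ (insert x (outside U)))
    fun j _ hj => hzero j hj, Finset.sum_insert (by simpa using hx)]
  congr 1
  · rw [← revMatrix_of_mem A hx, updateRow_eq_self, revPoly]
  · rw [Finset.mul_sum]
    refine Finset.sum_congr rfl fun j hj => ?_
    rw [det_revMatrix_updateRow_single A hx (mem_outside.1 hj)]
    ring

/-- Iterating the one-step expansion spells out the intermediate vertices of a simple path from `y`
to `x`; it stops because each step uses up a vertex outside `U`. -/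
theorem revMinor_eq_sum {U : Set V} {x : V} (hx : x ∈ U) (y : V) :
    revMinor A U x y = ∑ l ∈ freshLists U,
      C (walkWeight A (y :: (l ++ [x]))) * X ^ l.length * revPoly A (U ∪ {v | v ∈ l}) := by
  induction hn : (outside U).card generalizing U y with
  | zero =>
    rw [revMinor_eq_add_sum A hx, sum_freshLists, Finset.card_eq_zero.1 hn]
    simp
  | succ n ih =>
    rw [revMinor_eq_add_sum A hx, sum_freshLists]
    congr 1
    · simp
    · rw [Finset.mul_sum]
      refine Finset.sum_congr rfl fun j hj => ?_
      have hj' := mem_outside.1 hj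
      have hc := card_outside_insert hj'
      rw [ih (Or.inr hx) j (by omega), Finset.mul_sum, Finset.mul_sum]
      refine Finset.sum_congr rfl fun l _ => ?_
      have hU : insert j U ∪ {v | v ∈ l} = U ∪ {v | v ∈ j :: l} := by
        ext v
        simp [or_left_comm, or_assoc]
      rw [hU, List.cons_append, walkWeight_cons_cons, C_mul, List.length_cons]
      ring

theorem revPoly_insert_eq_sum {U : Set V} {x : V} (hx : x ∉ U) :
    revPoly A (insert x U) = revPoly A U + ∑ l ∈ freshLists (insert x U),
      C (walkWeight A (x :: (l ++ [x]))) * X ^ (l.length + 1) *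
        revPoly A (insert x U ∪ {v | v ∈ l}) := by
  rw [revPoly_eq_sub_revMinor A hx, revMinor_eq_sum A (Or.inl rfl), Finset.mul_sum,
    sub_add_eq_add_sub, eq_sub_iff_add_eq]
  congr 1
  refine Finset.sum_congr rfl fun l _ => ?_
  ring

theorem revPoly_univ : revPoly A Set.univ = 1 := by
  have : revMatrix A Set.univ = 1 := by
    funext i
    rw [revMatrix_of_mem A (Set.mem_univ i)]
    ext1 j
    rw [Matrix.one_apply, Pi.single_apply]
    simp only [eq_comm]
  rw [revPoly, this, det_one]

theorem revPoly_empty : revPoly A ∅ = A.charpolyRev := by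
  have : revMatrix A ∅ = 1 - (X : ℂ[X]) • A.map C := by
    funext i
    rw [revMatrix_of_notMem A (Set.notMem_empty i)]
    ext1 j
    simp only [Pi.add_apply, Pi.smul_apply, Matrix.sub_apply, Matrix.smul_apply, Matrix.map_apply,
      Matrix.one_apply, Pi.single_apply, smul_eq_mul, eq_comm (a := j)]
    ring
  rw [revPoly, this, charpolyRev]

/-- The rows in `U` are identity rows, so the matrix is block triangular with an identity block. -/
theorem eval_revPoly (U : Set V) (z : ℂ) : (revPoly A U).eval z = detOff A U z := by
  classical
  set M : Matrix V V ℂ := (revMatrix A U).map (eval z) with hM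
  have hmem : ∀ i ∈ U, ∀ j, M i j = if i = j then 1 else 0 := by
    intro i hi j
    rw [hM, Matrix.map_apply, revMatrix_of_mem A hi, Pi.single_apply]
    simp only [eq_comm (a := j)]
    split_ifs <;> simp
  have hnot : ∀ i ∉ U, ∀ j, M i j = (if i = j then 1 else 0) - z * A i j := by
    intro i hi j
    rw [hM, Matrix.map_apply, revMatrix_of_notMem A hi, Pi.add_apply, Pi.single_apply]
    simp only [eq_comm (a := j)]
    split_ifs <;> simp <;> ring
  have h1 : (revPoly A U).eval z = M.det := by
    rw [revPoly, hM]
    exact (evalRingHom z).map_det _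
  rw [h1, M.twoBlockTriangular_det (fun i => i ∉ U), detOff]
  · have h2 : M.toSquareBlockProp (fun i => ¬ i ∉ U) = 1 := by
      ext i j
      rw [toSquareBlockProp_def, of_apply, hmem _ (not_not.1 i.2), Matrix.one_apply]
      simp only [Subtype.ext_iff]
    rw [h2, det_one, mul_one]
    congr! 1
    ext i j
    rw [toSquareBlockProp_def, of_apply, hnot _ i.2]
    by_cases hij : i = j
    · subst hij
      simp
    · simp [hij, Subtype.coe_ne_coe.2 hij]
  · intro i hi j hj
    rw [hmem i (not_not.1 hi), if_neg]
    rintro rfl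
    exact hi hj

end Determinant

/-! ### The sieve as a polynomial in the shift operator. -/

section Shift

open Polynomial

/-- The shift `F ↦ F (· - 1)` of sequences. -/
def shift : Module.End ℂ (ℤ → ℂ) where
  toFun F n := F (n - 1)
  map_add' _ _ := rfl
  map_smul' _ _ := rfl

theorem shift_apply (F : ℤ → ℂ) (n : ℤ) : shift F n = F (n - 1) := rfl

theorem shift_pow_apply (k : ℕ) (F : ℤ → ℂ) (n : ℤ) : (shift ^ k) F n = F (n - k) := by
  induction k generalizing n with
  | zero => simp
  | succ k ih =>
    rw [pow_succ', Module.End.mul_apply, shift_apply, ih]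
    push_cast
    ring_nf

theorem aeval_shift_apply (d : ℂ[X]) (F : ℤ → ℂ) (n : ℤ) :
    aeval shift d F n = ∑ j ∈ Finset.range (d.natDegree + 1), d.coeff j * F (n - j) := by
  rw [aeval_eq_sum_range, LinearMap.sum_apply, Finset.sum_apply]
  simp [shift_pow_apply]

variable {V : Type*} [Fintype V] [DecidableEq V] (A : Matrix V V ℂ)

/-- The sieve: hikes without right prime divisor off `U` are counted by `ζ · det (1 - X A_{G∖U})`. -/
theorem sieved_eq_aeval (U : Set V) :
    sieved A U = aeval shift (revPoly A U) (sieved A Set.univ) := by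
  -- The recursion is solved for `U`; every other set in it contains `insert x U` and so leaves
  -- fewer vertices outside.
  induction hn : (outside U).card using Nat.strong_induction_on generalizing U with
  | _ n ih =>
    by_cases hU : U = Set.univ
    · subst hU
      rw [revPoly_univ, map_one, Module.End.one_apply]
    · obtain ⟨x, hx⟩ := (Set.ne_univ_iff_exists_notMem U).1 hU
      have hc := card_outside_insert hx
      have h1 := ih _ (by omega) (insert x U) rfl
      funext m
      have h2 := sieved_insert_eq_sum (A := A) hx m
      rw [← sub_eq_iff_eq_add] at h2
      rw [← h2, h1, revPoly_insert_eq_sum A hx, map_add, map_sum, LinearMap.add_apply,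
        LinearMap.sum_apply, Pi.add_apply, Finset.sum_apply, sub_eq_iff_eq_add]
      congr 1
      refine Finset.sum_congr rfl fun l hl => ?_
      have hle : (outside (insert x U ∪ {v | v ∈ l})).card ≤ (outside (insert x U)).card :=
        Finset.card_le_card fun y hy =>
          mem_outside.2 fun h => mem_outside.1 hy (Or.inl h)
      rw [ih _ (by omega) (insert x U ∪ {v | v ∈ l}) rfl]
      simp only [map_mul, map_pow, aeval_C, aeval_X, Module.End.mul_apply,
        Module.algebraMap_end_apply, Pi.smul_apply, shift_pow_apply, smul_eq_mul]

end Shift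

/-! ### The zeta function, its dominant pole, the limit and the error series. -/

section Asymptotics

open Polynomial

theorem reverse_multiset_prod_X_sub_C (M : Multiset ℂ) :
    (M.map fun a => X - C a).prod.reverse = (M.map fun a => 1 - C a * X).prod := by
  have h : ∀ a : ℂ, (X - C a).reverse = 1 - C a * X := by
    intro a
    have h1 : X - C a = 1 * X + C (-a) := by simp [sub_eq_add_neg]
    rw [h1, reverse_add_C, reverse_mul_X, ← C_1, reverse_C]
    simp [sub_eq_add_neg]
  induction M using Multiset.induction_on with
  | empty => simp [← C_1, -map_one]
  | cons a M ih => rw [Multiset.map_cons, Multiset.prod_cons, reverse_mul_of_domain, ih, h,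
      Multiset.map_cons, Multiset.prod_cons]

theorem charpolyRev_eq_prod_roots {V : Type*} [Fintype V] [DecidableEq V] (A : Matrix V V ℂ) :
    A.charpolyRev = (A.charpoly.roots.map fun a => 1 - C a * X).prod := by
  rw [← reverse_multiset_prod_X_sub_C, ← Matrix.reverse_charpoly]
  congr 1
  exact (IsAlgClosed.splits A.charpoly).eq_prod_roots_of_monic A.charpoly_monic

/-- The inverse of `∏ (1 - c X)` with all `c` in the open unit disk has absolutely summable
coefficients, whose sum does not vanish. -/
theorem exists_summable_inverse (M : Multiset ℂ) (hM : ∀ c ∈ M, ‖c‖ < 1) :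
    ∃ q : PowerSeries ℂ, q * (M.map fun c => 1 - PowerSeries.C c * PowerSeries.X).prod = 1 ∧
      Summable (fun n => ‖PowerSeries.coeff n q‖) ∧ ∑' n, PowerSeries.coeff n q ≠ 0 := by
  induction M using Multiset.induction_on with
  | empty =>
    refine ⟨1, by simp, ?_, ?_⟩
    · refine summable_of_ne_finset_zero (s := {0}) fun n hn => ?_
      rw [PowerSeries.coeff_one, if_neg (by simpa using hn), norm_zero]
    · rw [tsum_eq_single 0 fun n hn => by rw [PowerSeries.coeff_one, if_neg hn]]
      simp
  | cons c M ih =>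
    obtain ⟨q, hq, hs, h0⟩ := ih fun a ha => hM a (Multiset.mem_cons_of_mem ha)
    have hc : ‖c‖ < 1 := hM c (Multiset.mem_cons_self c M)
    -- The new factor is inverted by a geometric series. Cauchy products preserve absolute
    -- summability and multiply the sums, here by `(1 - c)⁻¹ ≠ 0`.
    set g : PowerSeries ℂ := PowerSeries.mk fun n => c ^ n with hg
    have hgs : Summable fun n => ‖PowerSeries.coeff n g‖ := by
      simpa [hg] using hc
    have hg1 : g * (1 - PowerSeries.C c * PowerSeries.X) = 1 := by
      have : g * (1 - PowerSeries.C c * PowerSeries.X)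
          = g - PowerSeries.C c * (g * PowerSeries.X) := by ring
      rw [this]
      ext n
      cases n with
      | zero => simp [hg]
      | succ n =>
        rw [map_sub, PowerSeries.coeff_C_mul, PowerSeries.coeff_succ_mul_X]
        simp [hg, PowerSeries.coeff_one, pow_succ']
    refine ⟨g * q, ?_, ?_, ?_⟩
    · rw [Multiset.map_cons, Multiset.prod_cons, mul_mul_mul_comm, hg1, hq, one_mul]
    · have := summable_norm_sum_mul_antidiagonal_of_summable_norm
        (f := fun n => PowerSeries.coeff n g) (g := fun n => PowerSeries.coeff n q) hgs hs
      simpa only [PowerSeries.coeff_mul] using this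
    · have := tsum_mul_tsum_eq_tsum_sum_antidiagonal_of_summable_norm
        (f := fun n => PowerSeries.coeff n g) (g := fun n => PowerSeries.coeff n q) hgs hs
      simp only [PowerSeries.coeff_mul]
      rw [← this]
      refine mul_ne_zero ?_ h0
      simp only [hg, PowerSeries.coeff_mk, tsum_geometric_of_norm_lt_one hc]
      refine inv_ne_zero (sub_ne_zero.2 ?_)
      rintro rfl
      simp at hc

variable {V : Type*} {A : Matrix V V ℂ}

theorem coeff_zeta (A : Matrix V V ℂ) (n : ℕ) :
    PowerSeries.coeff n (zeta A) = sieved A Set.univ n := by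
  rw [zeta, PowerSeries.coeff_mk, sieved_univ]

theorem zetaCoeff_of_neg (lam : ℂ) {n : ℤ} (hn : n < 0) : zetaCoeff A lam n = 0 :=
  if_neg (not_le.2 hn)

theorem tendsto_zetaCoeff_sub {lam L : ℂ}
    (h : Tendsto (fun l : ℕ => zetaCoeff A lam l) atTop (𝓝 L)) (m : ℕ) :
    Tendsto (fun l : ℕ => zetaCoeff A lam ((l : ℤ) - m)) atTop (𝓝 L) := by
  refine (h.comp (tendsto_sub_atTop_nat m)).congr' ?_
  filter_upwards [eventually_ge_atTop m] with l hl
  rw [Function.comp_apply, Nat.cast_sub hl]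

theorem sieveRatio_eq (U : Set V) (m l : ℕ) :
    sieveRatio A U m l = sieved A U ((l : ℤ) - m) / sieved A Set.univ l := by
  rw [sieved_univ]
  rfl

theorem zetaCoeff_eq (A : Matrix V V ℂ) (lam : ℂ) (n : ℤ) :
    zetaCoeff A lam n = lam⁻¹ ^ n * sieved A Set.univ n := by
  rw [zetaCoeff]
  split_ifs with h
  · lift n to ℕ using h
    rw [PowerSeries.coeff_rescale, Int.toNat_natCast, coeff_zeta, zpow_natCast]
  · rw [sieved_of_neg _ (not_le.1 h), mul_zero]

theorem sieved_univ_eq {lam : ℂ} (hlam0 : lam ≠ 0) (n : ℤ) :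
    sieved A Set.univ n = lam ^ n * zetaCoeff A lam n := by
  rw [zetaCoeff_eq, ← mul_assoc, ← mul_zpow, mul_inv_cancel₀ hlam0, one_zpow, one_mul]

theorem eventually_totalWeight_ne_zero {lam L : ℂ} (hlam0 : lam ≠ 0) (hL : L ≠ 0)
    (h : Tendsto (fun l : ℕ => zetaCoeff A lam l) atTop (𝓝 L)) :
    ∀ᶠ l : ℕ in atTop, totalWeight (hikesOfLength A l) ≠ 0 := by
  filter_upwards [h.eventually_ne hL] with l hl
  rw [← sieved_univ, sieved_univ_eq hlam0]
  exact mul_ne_zero (zpow_ne_zero _ hlam0) hl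

/-- On `lam ^ n * f n` one application gives `lam ^ (n - 1) * (f (n - 1) - f n)`, that is, `-lam ^
(n - 1)` times the backward difference. -/
theorem shift_sub_pow_apply {lam : ℂ} (hlam0 : lam ≠ 0) (k : ℕ) (n : ℤ) :
    ((shift - algebraMap ℂ _ (1 / lam)) ^ k) (sieved A Set.univ) n =
      (-1) ^ k * lam ^ (n - k) * backwardDiff^[k] (zetaCoeff A lam) n := by
  induction k generalizing n with
  | zero => simp [sieved_univ_eq hlam0]
  | succ k ih =>
    rw [pow_succ', Module.End.mul_apply, LinearMap.sub_apply, Pi.sub_apply, shift_apply,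
      Module.algebraMap_end_apply, Pi.smul_apply, ih, ih, Function.iterate_succ_apply',
      backwardDiff]
    have h1 : lam ^ (n - 1 - k) = lam ^ (n - (k + 1 : ℕ)) := by
      congr 1
      push_cast
      ring
    have h2 : lam ^ (n - k) = lam ^ (n - (k + 1 : ℕ)) * lam := by
      rw [← zpow_add_one₀ hlam0]
      congr 1
      push_cast
      ring
    rw [h1, h2, smul_eq_mul]
    field_simp
    ring

variable [Fintype V] [DecidableEq V]

/-- The generating function of the hikes is the inverse of `det (1 - X A)`. -/
theorem zeta_mul_charpolyRev (A : Matrix V V ℂ) :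
    zeta A * (A.charpolyRev : PowerSeries ℂ) = 1 := by
  ext n
  have h1 := congrFun (sieved_eq_aeval A ∅) n
  rw [aeval_shift_apply, revPoly_empty] at h1
  have h2 : sieved A ∅ n = PowerSeries.coeff n (1 : PowerSeries ℂ) := by
    rw [PowerSeries.coeff_one]
    split_ifs with h
    · rw [h, Nat.cast_zero, sieved_zero]
    · exact sieved_empty (by exact_mod_cast h)
  rw [← h2, h1, mul_comm, PowerSeries.coeff_mul,
    Finset.Nat.sum_antidiagonal_eq_sum_range_succ_mk]
  set d := A.charpolyRev
  -- The operator sums up to the degree, the power series product up to `n`. Both extend to the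
  -- maximum: coefficients vanish beyond the degree, hike weights at negative lengths.
  have h3 : ∀ N : ℕ, n ≤ N → d.natDegree ≤ N →
      ∑ j ∈ Finset.range (d.natDegree + 1), d.coeff j * sieved A Set.univ ((n : ℤ) - j) =
        ∑ j ∈ Finset.range (N + 1), d.coeff j * sieved A Set.univ ((n : ℤ) - j) := by
    intro N _ hd
    refine Finset.sum_subset (Finset.range_mono (by omega)) fun j _ hj => ?_
    rw [coeff_eq_zero_of_natDegree_lt (by simpa using hj), zero_mul]
  have h4 : ∑ j ∈ Finset.range (n + 1), d.coeff j * sieved A Set.univ ((n : ℤ) - j) =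
        ∑ j ∈ Finset.range (max n d.natDegree + 1),
          d.coeff j * sieved A Set.univ ((n : ℤ) - j) := by
    refine Finset.sum_subset (Finset.range_mono (by omega)) fun j _ hj => ?_
    rw [Finset.mem_range] at hj
    rw [sieved_of_neg _ (by omega), mul_zero]
  rw [h3 (max n d.natDegree) (le_max_left _ _) (le_max_right _ _), ← h4]
  refine Finset.sum_congr rfl fun j hj => ?_
  rw [Finset.mem_range] at hj
  rw [Polynomial.coeff_coe, coeff_zeta, Nat.cast_sub (by omega)]

/-- Rescaling by `lam⁻¹` turns the factor of `lam` in `det (1 - zA)` into `1 - X` and the others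
into `1 - cX` with `‖c‖ < 1`. Thus `q` is the inverse of the latter, and dividing by `1 - X` takes
partial sums. -/
theorem exists_summable_zetaCoeff {lam : ℂ} (hlam0 : lam ≠ 0) (hlam : IsUniqueDominant A lam) :
    ∃ q : ℕ → ℂ, Summable (fun n => ‖q n‖) ∧ ∑' n, q n ≠ 0 ∧
      ∀ n : ℕ, zetaCoeff A lam n = ∑ k ∈ Finset.range (n + 1), q k := by
  obtain ⟨hmult, hdom⟩ := hlam
  have hroot : lam ∈ A.charpoly.roots := by
    rw [← Multiset.count_pos, count_roots, hmult]
    exact one_pos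
  obtain ⟨M, hM⟩ := Multiset.exists_cons_of_mem hroot
  -- Multiplicity one is used here: a second copy of `lam` would give `c = 1`.
  have hlM : lam ∉ M := by
    rw [← count_roots, hM, Multiset.count_cons_self] at hmult
    rw [← Multiset.count_eq_zero]
    omega
  have hlt : ∀ c ∈ M.map (fun μ => lam⁻¹ * μ), ‖c‖ < 1 := by
    intro c hc
    obtain ⟨μ, hμ, rfl⟩ := Multiset.mem_map.1 hc
    have h1 : μ ∈ A.charpoly.roots := hM ▸ Multiset.mem_cons_of_mem hμ
    have h2 := hdom μ (isRoot_of_mem_roots h1) fun h => hlM (h ▸ hμ)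
    rw [norm_mul, norm_inv, inv_mul_lt_one₀ (norm_pos_iff.2 hlam0)]
    exact h2
  obtain ⟨q, hq, hs, h0⟩ := exists_summable_inverse _ hlt
  set F := PowerSeries.rescale lam⁻¹ (zeta A) with hF
  have hfac : ∀ a : ℂ, PowerSeries.rescale lam⁻¹ ((1 - C a * X : ℂ[X]) : PowerSeries ℂ) =
      1 - PowerSeries.C (lam⁻¹ * a) * PowerSeries.X := by
    intro a
    ext n
    simp only [coe_sub, coe_one, coe_mul, coe_C, coe_X, PowerSeries.coeff_rescale, map_sub,
      PowerSeries.coeff_one, PowerSeries.coeff_C_mul, PowerSeries.coeff_X]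
    rcases n with _ | _ | n <;> simp
  have hF1 : F * (1 - PowerSeries.X) = q := by
    have h1 := congrArg (PowerSeries.rescale lam⁻¹) (zeta_mul_charpolyRev A)
    rw [map_mul, map_one, charpolyRev_eq_prod_roots, hM, Multiset.map_cons, Multiset.prod_cons,
      coe_mul, map_mul, hfac, inv_mul_cancel₀ hlam0, map_one, one_mul] at h1
    have h2 : PowerSeries.rescale lam⁻¹
        (((M.map fun a => (1 - C a * X : ℂ[X])).prod : ℂ[X]) : PowerSeries ℂ) =
        ((M.map (fun μ => lam⁻¹ * μ)).map
          fun c => 1 - PowerSeries.C c * PowerSeries.X).prod := by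
      have := map_multiset_prod ((PowerSeries.rescale lam⁻¹).comp
        (coeToPowerSeries.ringHom (R := ℂ))) (M.map fun a => (1 - C a * X : ℂ[X]))
      simp only [RingHom.comp_apply, coeToPowerSeries.ringHom_apply, Multiset.map_map,
        Function.comp_def, hfac] at this
      rw [this, Multiset.map_map]
      rfl
    rw [h2] at h1
    set P := ((M.map (fun μ => lam⁻¹ * μ)).map
      fun c => 1 - PowerSeries.C c * PowerSeries.X).prod
    calc F * (1 - PowerSeries.X) = F * (1 - PowerSeries.X) * (q * P) := by rw [hq, mul_one]
      _ = q * (F * ((1 - PowerSeries.X) * P)) := by ring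
      _ = q := by rw [hF, h1, mul_one]
  refine ⟨fun n => PowerSeries.coeff n q, hs, h0, fun n => ?_⟩
  have hn : ∀ n : ℕ, zetaCoeff A lam n = PowerSeries.coeff n F := fun n => by
    rw [zetaCoeff, if_pos (Int.natCast_nonneg n), Int.toNat_natCast]
  rw [hn]
  simp only [← hF1, mul_sub, mul_one, map_sub]
  induction n with
  | zero => simp
  | succ n ih => rw [Finset.sum_range_succ, ← ih, PowerSeries.coeff_succ_mul_X]; ring

theorem exists_tendsto_zetaCoeff {lam : ℂ} (hlam0 : lam ≠ 0) (hlam : IsUniqueDominant A lam) :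
    ∃ L : ℂ, L ≠ 0 ∧ Tendsto (fun l : ℕ => zetaCoeff A lam l) atTop (𝓝 L) := by
  obtain ⟨q, hs, h0, hq⟩ := exists_summable_zetaCoeff hlam0 hlam
  refine ⟨_, h0, ?_⟩
  simp only [hq]
  exact hs.of_norm.hasSum.tendsto_sum_nat.comp (tendsto_add_atTop_nat 1)

theorem exists_bound_zetaCoeff {lam : ℂ} (hlam0 : lam ≠ 0) (hlam : IsUniqueDominant A lam) :
    ∃ K : ℝ, ∀ n : ℤ, ‖zetaCoeff A lam n‖ ≤ K := by
  obtain ⟨q, hs, -, hq⟩ := exists_summable_zetaCoeff hlam0 hlam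
  refine ⟨∑' n, ‖q n‖, fun n => ?_⟩
  rcases lt_or_ge n 0 with hn | hn
  · rw [zetaCoeff_of_neg lam hn, norm_zero]
    exact tsum_nonneg fun _ => norm_nonneg _
  · lift n to ℕ using hn
    rw [hq]
    exact (norm_sum_le _ _).trans (hs.sum_le_tsum _ fun _ _ => norm_nonneg _)

theorem tendsto_sieveRatio {lam L : ℂ} (hlam0 : lam ≠ 0) (hL : L ≠ 0)
    (h : Tendsto (fun l : ℕ => zetaCoeff A lam l) atTop (𝓝 L)) (U : Set V) (m : ℕ) :
    Tendsto (fun l : ℕ => sieveRatio A U m l) atTop (𝓝 (mainTerm A lam U m)) := by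
  -- No `l` need be excluded: if `f l = 0`, both sides are zero by the convention for division.
  have h1 : ∀ l : ℕ, sieveRatio A U m l = ∑ j ∈ Finset.range ((revPoly A U).natDegree + 1),
      (1 / lam ^ m) * ((revPoly A U).coeff j * (1 / lam) ^ j) *
        (zetaCoeff A lam ((l : ℤ) - (m + j : ℕ)) / zetaCoeff A lam l) := by
    intro l
    rw [sieveRatio_eq, sieved_eq_aeval, aeval_shift_apply, Finset.sum_div]
    refine Finset.sum_congr rfl fun j _ => ?_
    rw [sieved_univ_eq hlam0, sieved_univ_eq hlam0]
    have h2 : lam ^ ((l : ℤ) - m - j) = lam ^ (l : ℤ) * (1 / lam ^ m) * (1 / lam) ^ j := by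
      rw [zpow_sub₀ hlam0, zpow_sub₀ hlam0, zpow_natCast, zpow_natCast, zpow_natCast, one_div_pow]
      ring
    rw [h2, Nat.cast_add, ← sub_sub]
    have h3 : lam ^ (l : ℤ) ≠ 0 := zpow_ne_zero _ hlam0
    field_simp
  have h2 : mainTerm A lam U m = ∑ j ∈ Finset.range ((revPoly A U).natDegree + 1),
      (1 / lam ^ m) * ((revPoly A U).coeff j * (1 / lam) ^ j) * (L / L) := by
    rw [mainTerm, ← eval_revPoly, eval_eq_sum_range, Finset.mul_sum]
    simp [div_self hL]
  simp only [h1, h2]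
  exact tendsto_finsetSum _ fun j _ => ((tendsto_zetaCoeff_sub h _).div h hL).const_mul _

theorem iteratedDeriv_eval (p : ℂ[X]) (k : ℕ) :
    iteratedDeriv k (fun z => p.eval z) = fun z => (derivative^[k] p).eval z := by
  induction k with
  | zero => simp
  | succ k ih =>
    rw [iteratedDeriv_succ, ih, Function.iterate_succ_apply']
    ext z
    exact Polynomial.deriv _

theorem iteratedDeriv_detOff (U : Set V) (k : ℕ) (z : ℂ) :
    iteratedDeriv k (detOff A U) z = k.factorial * (taylor z (revPoly A U)).coeff k := by
  have h : detOff A U = fun z => (revPoly A U).eval z := funext fun z => (eval_revPoly A U z).symm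
  rw [h, iteratedDeriv_eval, taylor_coeff, ← factorial_smul_hasseDeriv]
  simp

/-- The determinant is expanded around `1 / lam`, so that powers of the shift minus `1 / lam`
appear, which are backward differences. -/
theorem sieved_eq_sum_taylor {lam : ℂ} (hlam0 : lam ≠ 0) (U : Set V) (n : ℤ) :
    sieved A U n = ∑ k ∈ Finset.range ((revPoly A U).natDegree + 1),
      (taylor (1 / lam) (revPoly A U)).coeff k *
        ((-1) ^ k * lam ^ (n - k) * backwardDiff^[k] (zetaCoeff A lam) n) := by
  rw [sieved_eq_aeval]
  conv_lhs => rw [← sum_taylor_eq (revPoly A U) (1 / lam)]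
  rw [sum_over_range _ (by simp), natDegree_taylor, map_sum, LinearMap.sum_apply,
    Finset.sum_apply]
  refine Finset.sum_congr rfl fun k _ => ?_
  rw [← shift_sub_pow_apply hlam0, map_mul, map_pow, map_sub, aeval_C, aeval_X, aeval_C,
    Module.End.mul_apply, Module.algebraMap_end_apply, Pi.smul_apply, smul_eq_mul]

theorem hasSum_errTerm {lam : ℂ} (hlam0 : lam ≠ 0) (U : Set V) (m l : ℕ)
    (hl : totalWeight (hikesOfLength A l) ≠ 0) :
    HasSum (errTerm A lam U m l) (sieveRatio A U m l - mainTerm A lam U m) := by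
  rw [← sieved_univ, sieved_univ_eq hlam0] at hl
  have hf : zetaCoeff A lam l ≠ 0 := right_ne_zero_of_mul hl
  -- The series is a finite sum: derivatives beyond the degree of the determinant vanish.
  have h0 : ∀ k ∉ Finset.range ((revPoly A U).natDegree + 1), errTerm A lam U m l k = 0 := by
    intro k hk
    rw [errTerm, iteratedDeriv_detOff, coeff_eq_zero_of_natDegree_lt
      (by simpa [natDegree_taylor] using hk)]
    simp
  suffices sieveRatio A U m l - mainTerm A lam U m =
      ∑ k ∈ Finset.range ((revPoly A U).natDegree + 1), errTerm A lam U m l k from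
    this ▸ hasSum_sum_of_ne_finset_zero h0
  have h1 : ∀ k, errTerm A lam U m l k = (taylor (1 / lam) (revPoly A U)).coeff k *
        ((-1) ^ k * lam ^ ((l : ℤ) - m - k) * backwardDiff^[k] (zetaCoeff A lam) ((l : ℤ) - m))
          / sieved A Set.univ l - if k = 0 then mainTerm A lam U m else 0 := by
    intro k
    have h2 : lam ^ ((l : ℤ) - m - k) = lam ^ (l : ℤ) * (1 / lam ^ m) * (1 / lam ^ k) := by
      rw [zpow_sub₀ hlam0, zpow_sub₀ hlam0, zpow_natCast, zpow_natCast, zpow_natCast]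
      ring
    have h3 : lam ^ (l : ℤ) ≠ 0 := zpow_ne_zero _ hlam0
    have h4 : (k.factorial : ℂ) ≠ 0 := Nat.cast_ne_zero.2 k.factorial_ne_zero
    have h5 : (if k = 0 then mainTerm A lam U m else 0) = (1 / lam ^ m) *
        ((if k = 0 then 1 else 0) *
          (k.factorial * (taylor (1 / lam) (revPoly A U)).coeff k)) := by
      split_ifs with hk
      · subst hk
        rw [mainTerm, ← eval_revPoly, taylor_coeff_zero]
        simp
      · simp
    rw [errTerm, iteratedDeriv_detOff, h5, h2, sieved_univ_eq hlam0]
    field_simp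
  simp only [h1]
  rw [Finset.sum_sub_distrib, ← Finset.sum_div, ← sieved_eq_sum_taylor hlam0, sieveRatio_eq]
  simp

end Asymptotics

/-! ### Loop-erasure of walks and its agreement with the sieve. -/

section LoopErasure

variable {V : Type*}

/-- The weight of the edge from the head of a list to `x`. -/
def stepWeight (A : Matrix V V ℂ) : List V → V → ℂ
  | [], _ => 1
  | a :: _, x => A a x

theorem walkWeight_reverse_append (A : Matrix V V ℂ) (s : List V) (x : V) :
    walkWeight A (s.reverse ++ [x]) = walkWeight A s.reverse * stepWeight A s x := by
  cases s with
  | nil => simp [stepWeight, walkWeight]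
  | cons a s =>
    rw [List.reverse_cons, List.append_assoc]
    exact walkWeight_append_pair A _ a x

theorem walkWeight_append_cons (A : Matrix V V ℂ) (a b : List V) (x : V) :
    walkWeight A (a ++ x :: b) = walkWeight A (a ++ [x]) * walkWeight A (x :: b) := by
  induction a with
  | nil => simp
  | cons c a ih =>
    cases a with
    | nil => simp
    | cons d a =>
      simp only [List.cons_append, walkWeight_cons_cons] at ih ⊢
      rw [ih, mul_assoc]

theorem coe_reverse_eq_iff {v : V} {r s : List V} (hr : (v :: r).Nodup)
    (hs : s.getLast? = some v) :
    (s.reverse : Cycle V) = ((v :: r : List V) : Cycle V) ↔ s = (v :: r).reverse := by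
  constructor
  · intro h
    obtain ⟨c, rfl⟩ := List.getLast?_eq_some_iff.1 hs
    rw [List.reverse_append, List.reverse_singleton, List.singleton_append,
      Cycle.coe_eq_coe] at h
    rw [eq_of_cons_isRotated_cons hr h.symm, List.reverse_cons, List.reverse_reverse]
  · rintro rfl
    rw [List.reverse_reverse]

variable [DecidableEq V]

theorem eraseStep_of_notMem {s : List V × List V} {x : V} (h : x ∉ s.1) :
    eraseStep s x = (x :: s.1, s.2) :=
  if_neg h

theorem eraseStep_append {c t : List V} {x : V} (h : x ∉ c) (r : List V) :
    eraseStep (c ++ x :: t, r) x = (x :: t, x :: c.reverse) := by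
  have h1 : ∀ a ∈ c, decide (a ≠ x) = true := fun a ha => by
    simpa using fun hax : a = x => h (hax ▸ ha)
  rw [eraseStep, if_pos (by simp)]
  dsimp only
  rw [List.dropWhile_append_of_pos h1, List.takeWhile_append_of_pos h1]
  simp

theorem fst_eraseStep_congr (s r r' : List V) (x : V) :
    (eraseStep (s, r) x).1 = (eraseStep (s, r') x).1 := by
  by_cases h : x ∈ s <;> simp [eraseStep, h]

/-- The state of the chronological loop-erasure after a walk. -/
def eraseState (w : List V) : List V × List V := w.foldl eraseStep ([], [])

theorem eraseState_append_singleton (w : List V) (x : V) :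
    eraseState (w ++ [x]) = eraseStep (eraseState w) x := by
  simp [eraseState]

theorem head?_eraseStep (s : List V × List V) (x : V) : (eraseStep s x).1.head? = some x := by
  obtain ⟨s, r⟩ := s
  by_cases h : x ∈ s
  · obtain ⟨c, t, rfl, hc⟩ := List.eq_append_cons_of_mem h
    rw [eraseStep_append hc, List.head?_cons]
  · rw [eraseStep_of_notMem h, List.head?_cons]

theorem nodup_eraseStep {s : List V × List V} (hs : s.1.Nodup) (x : V) :
    (eraseStep s x).1.Nodup := by
  obtain ⟨s, r⟩ := s
  by_cases h : x ∈ s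
  · obtain ⟨c, t, rfl, hc⟩ := List.eq_append_cons_of_mem h
    rw [eraseStep_append hc]
    exact hs.of_append_right
  · rw [eraseStep_of_notMem h]
    exact List.nodup_cons.2 ⟨h, hs⟩

theorem getLast?_eraseStep {s : List V × List V} {u : V} (hs : s.1.getLast? = some u) (x : V) :
    (eraseStep s x).1.getLast? = some u := by
  obtain ⟨s, r⟩ := s
  by_cases h : x ∈ s
  · obtain ⟨c, t, rfl, hc⟩ := List.eq_append_cons_of_mem h
    rw [eraseStep_append hc]
    simpa using hs
  · rw [eraseStep_of_notMem h]
    dsimp only at hs ⊢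
    rw [List.getLast?_cons, hs]
    rfl

theorem nodup_eraseState (w : List V) : (eraseState w).1.Nodup := by
  induction w using List.reverseRecOn with
  | nil => exact List.nodup_nil
  | append_singleton w x ih =>
    rw [eraseState_append_singleton]
    exact nodup_eraseStep ih x

theorem head?_eraseState (w : List V) : (eraseState w).1.head? = w.getLast? := by
  induction w using List.reverseRecOn with
  | nil => rfl
  | append_singleton w x ih =>
    rw [eraseState_append_singleton, head?_eraseStep, List.getLast?_concat]

theorem getLast?_eraseState (w : List V) : (eraseState w).1.getLast? = w.head? := by
  induction w using List.reverseRecOn with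
  | nil => rfl
  | append_singleton w x ih =>
    rw [eraseState_append_singleton]
    cases w with
    | nil => rfl
    | cons a w => exact getLast?_eraseStep ih x

theorem loopErasure_eq (w : List V) : loopErasure w = (eraseState w).1.reverse := rfl

theorem lastErasedLoop_eq (w : List V) : lastErasedLoop w = ((eraseState w).2 : Cycle V) := rfl

/-- The starting vertex always stays at the bottom of the current path, so returning to it erases
the whole path. -/
theorem lastErasedLoop_append_head {w : List V} {v : V} (h : w.head? = some v) :
    lastErasedLoop (w ++ [v]) = ((eraseState w).1.reverse : Cycle V) := by
  have h1 := getLast?_eraseState w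
  rw [h, List.getLast?_eq_some_iff] at h1
  obtain ⟨c, hc⟩ := h1
  have hnd := nodup_eraseState w
  rw [hc] at hnd
  have hv : v ∉ c := fun hv => (List.nodup_append.1 hnd).2.2 v hv v (by simp) rfl
  have h2 : eraseState w = (c ++ v :: [], (eraseState w).2) := Prod.ext hc rfl
  rw [lastErasedLoop_eq, eraseState_append_singleton, h2, eraseStep_append hv]
  simp

/-- The head of the erasure state is the last vertex of the walk, so the state alone determines the
weight of the next step. -/
theorem walkWeight_append_singleton (A : Matrix V V ℂ) (w : List V) (x : V) :
    walkWeight A (w ++ [x]) = walkWeight A w * stepWeight A (eraseState w).1 x := by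
  have h := walkWeight_reverse_append A w.reverse x
  rw [List.reverse_reverse] at h
  rw [h]
  congr 1
  have h1 : w.reverse.head? = (eraseState w).1.head? := by
    rw [List.head?_reverse, head?_eraseState]
  revert h1
  cases w.reverse <;> cases (eraseState w).1 <;> simp +contextual [stepWeight]

variable [Fintype V]

/-- The lists of `n + 1` vertices starting with `u`. -/
def vertexLists (u : V) : ℕ → Finset (List V)
  | 0 => {[u]}
  | n + 1 => (vertexLists u n ×ˢ Finset.univ).image fun q => q.1 ++ [q.2]

theorem mem_vertexLists {u : V} {n : ℕ} {w : List V} :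
    w ∈ vertexLists u n ↔ w.length = n + 1 ∧ w.head? = some u := by
  induction n generalizing w with
  | zero =>
    rw [vertexLists, Finset.mem_singleton, zero_add, List.length_eq_one_iff]
    constructor
    · rintro rfl
      exact ⟨⟨u, rfl⟩, rfl⟩
    · rintro ⟨⟨a, rfl⟩, h⟩
      simpa using h
  | succ n ih =>
    simp only [vertexLists, Finset.mem_image, Finset.mem_product, Finset.mem_univ, and_true,
      Prod.exists, ih]
    constructor
    · rintro ⟨w, x, ⟨h1, h2⟩, rfl⟩
      exact ⟨by simp [h1], by simp [h2]⟩
    · rintro ⟨h1, h2⟩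
      induction w using List.reverseRecOn with
      | nil => simp at h1
      | append_singleton w x _ =>
        have h3 : w.length = n + 1 := by simpa using h1
        refine ⟨w, x, ⟨h3, ?_⟩, rfl⟩
        cases w with
        | nil => simp at h3
        | cons a w => simpa using h2

theorem sum_vertexLists_succ (u : V) (n : ℕ) (φ : List V → ℂ) :
    ∑ w ∈ vertexLists u (n + 1), φ w = ∑ w ∈ vertexLists u n, ∑ x, φ (w ++ [x]) := by
  rw [vertexLists, Finset.sum_image, Finset.sum_product]
  rintro ⟨a, x⟩ _ ⟨b, y⟩ _ h
  obtain ⟨h1, h2⟩ := List.append_inj' h rfl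
  simp_all

/-- The total weight of the walks of length `n` from `u` whose loop-erasure is the reverse
of `s`. -/
def erasureWeight (A : Matrix V V ℂ) (u : V) (n : ℕ) (s : List V) : ℂ :=
  ∑ w ∈ vertexLists u n with (eraseState w).1 = s, walkWeight A w

/-- The possible predecessors of the state `x :: t`: either `x` is new on `t`, or the step to `x`
closes a loop made of `x` and fresh vertices. -/
theorem filter_eraseStep_eq {x : V} {t : List V} (h : (x :: t).Nodup) (r : List V → List V) :
    (freshLists (∅ : Set V)).filter (fun s => (eraseStep (s, r s) x).1 = x :: t) =
      insert t ((freshLists {v | v ∈ x :: t}).image fun l => l.reverse ++ x :: t) := by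
  ext s
  simp only [Finset.mem_filter, mem_freshLists, Set.mem_empty_iff_false, not_false_eq_true,
    implies_true, and_true, Finset.mem_insert, Finset.mem_image, Set.mem_ofPred_eq]
  constructor
  · rintro ⟨hs, he⟩
    by_cases hx : x ∈ s
    · obtain ⟨c, t', rfl, hc⟩ := List.eq_append_cons_of_mem hx
      rw [eraseStep_append hc] at he
      obtain ⟨h1, -, h2⟩ := List.nodup_append.1 hs
      refine Or.inr ⟨c.reverse, ⟨List.nodup_reverse.2 h1, fun y hy hyt => ?_⟩, ?_⟩
      · rw [← he] at hyt
        exact h2 y (List.mem_reverse.1 hy) y hyt rfl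
      · rw [List.reverse_reverse, ← he]
    · rw [eraseStep_of_notMem hx] at he
      exact Or.inl (List.cons.inj he).2
  · rintro (rfl | ⟨l, ⟨h1, h2⟩, rfl⟩)
    · rw [List.nodup_cons] at h
      exact ⟨h.2, by rw [eraseStep_of_notMem h.1]⟩
    · refine ⟨List.nodup_append.2 ⟨List.nodup_reverse.2 h1, h, ?_⟩, ?_⟩
      · rintro a ha _ hb rfl
        exact h2 a (List.mem_reverse.1 ha) hb
      · rw [eraseStep_append]
        exact fun hx => h2 x (List.mem_reverse.1 hx) List.mem_cons_self

theorem erasureWeight_succ (A : Matrix V V ℂ) (u : V) (n : ℕ) {x : V} {t : List V}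
    (h : (x :: t).Nodup) :
    erasureWeight A u (n + 1) (x :: t) = erasureWeight A u n t * stepWeight A t x +
      ∑ l ∈ freshLists {v | v ∈ x :: t}, erasureWeight A u n (l.reverse ++ x :: t) *
        stepWeight A (l.reverse ++ x :: t) x := by
  have h1 : erasureWeight A u (n + 1) (x :: t) = ∑ w ∈ vertexLists u n,
      if (eraseStep ((eraseState w).1, []) x).1 = x :: t then
        walkWeight A w * stepWeight A (eraseState w).1 x else 0 := by
    rw [erasureWeight, Finset.sum_filter, sum_vertexLists_succ]
    refine Finset.sum_congr rfl fun w _ => ?_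
    rw [Finset.sum_eq_single x]
    · rw [eraseState_append_singleton, walkWeight_append_singleton,
        fst_eraseStep_congr _ [] (eraseState w).2]
    · intro y _ hy
      rw [if_neg]
      intro he
      have := congrArg List.head? he
      rw [eraseState_append_singleton, head?_eraseStep] at this
      exact hy (by simpa using this)
    · simp
  have h2 : ∀ w ∈ vertexLists u n, (eraseState w).1 ∈ freshLists (∅ : Set V) := fun w _ =>
    mem_freshLists.2 ⟨nodup_eraseState w, fun _ _ h => h⟩
  have h3 : erasureWeight A u (n + 1) (x :: t) = ∑ s ∈ freshLists (∅ : Set V) with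
      (eraseStep (s, []) x).1 = x :: t, erasureWeight A u n s * stepWeight A s x := by
    rw [h1, ← Finset.sum_fiberwise_of_maps_to h2, Finset.sum_filter]
    refine Finset.sum_congr rfl fun s _ => ?_
    rw [erasureWeight, Finset.sum_mul]
    have h4 : ∀ w ∈ (vertexLists u n).filter (fun w => (eraseState w).1 = s),
        (if (eraseStep ((eraseState w).1, []) x).1 = x :: t then
          walkWeight A w * stepWeight A (eraseState w).1 x else 0) =
        if (eraseStep (s, []) x).1 = x :: t then walkWeight A w * stepWeight A s x else 0 := by
      intro w hw
      rw [(Finset.mem_filter.1 hw).2]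
    rw [Finset.sum_congr rfl h4]
    split_ifs
    · rfl
    · exact Finset.sum_const_zero
  rw [h3, filter_eraseStep_eq h fun _ => [], Finset.sum_insert, Finset.sum_image]
  · intro l _ l' _ hl
    exact List.reverse_injective (List.append_cancel_right hl)
  · intro ht
    obtain ⟨l, -, hl⟩ := Finset.mem_image.1 ht
    have := congrArg List.length hl
    simp at this
    omega

theorem totalWalkWeight_eq_erasureWeight (A : Matrix V V ℂ) (u : V) (n : ℕ) {s : List V} {v : V}
    (hv : s.head? = some v) :
    totalWalkWeight A {w | w ∈ walks A u v n ∧ (eraseState w).1 = s} = erasureWeight A u n s := by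
  refine finsum_mem_eq_sum_of_inter_support_eq _ ?_
  ext w
  simp only [Set.mem_inter_iff, Function.mem_support, Finset.coe_filter, mem_vertexLists,
    Set.mem_ofPred_eq, walks, walkWeight_ne_zero_iff]
  constructor
  · rintro ⟨⟨⟨-, h1, h2, -⟩, h3⟩, h4⟩
    exact ⟨⟨⟨h1, h2⟩, h3⟩, h4⟩
  · rintro ⟨⟨⟨h1, h2⟩, h3⟩, h4⟩
    exact ⟨⟨⟨h4, h1, h2, by rw [← head?_eraseState, h3, hv]⟩, h3⟩, h4⟩

theorem erasureWeight_nil (A : Matrix V V ℂ) (u : V) (n : ℕ) : erasureWeight A u n [] = 0 := by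
  rw [erasureWeight, Finset.filter_false_of_mem, Finset.sum_empty]
  intro w hw h
  have := getLast?_eraseState w
  rw [(mem_vertexLists.1 hw).2, h] at this
  simp at this

theorem erasureWeight_zero (A : Matrix V V ℂ) (u : V) (s : List V) :
    erasureWeight A u 0 s = if s = [u] then 1 else 0 := by
  rw [erasureWeight, vertexLists, Finset.sum_filter, Finset.sum_singleton, walkWeight_singleton]
  have : (eraseState [u]).1 = [u] := rfl
  rw [this]
  simp only [eq_comm]

/-- Conditioning on the last step reproduces the sieve recursion at the tip `x`: a new tip
corresponds to the smaller set, a closed loop to a prime through `x`. The argument of `sieved` is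
`n` minus the number `s.length - 1` of edges of the path. -/
theorem erasureWeight_eq (A : Matrix V V ℂ) (u : V) (n : ℕ) {s : List V} (hs : s.Nodup)
    (hu : s.getLast? = some u) :
    erasureWeight A u n s =
      walkWeight A s.reverse * sieved A {v | v ∈ s} ((n : ℤ) + 1 - s.length) := by
  induction n generalizing s with
  | zero =>
    rw [erasureWeight_zero]
    match s, hu with
    | [a], hu =>
      obtain rfl : a = u := by simpa using hu
      simp [sieved_zero]
    | a :: b :: t, _ =>
      rw [if_neg (by simp), sieved_of_neg, mul_zero]
      simp
      omega
  | succ n ih =>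
    match s, hu with
    | x :: t, hu =>
      have hx : x ∉ {v | v ∈ t} := (List.nodup_cons.1 hs).1
      have hset : {v | v ∈ x :: t} = insert x {v | v ∈ t} := by
        ext v
        simp
      rw [erasureWeight_succ A u n hs, hset, sieved_insert_eq_sum hx, mul_add]
      congr 1
      -- For a one-vertex path the predecessor would be the empty state, which no walk reaches;
      -- correspondingly `sieved A ∅` vanishes at the positive length `n + 1`.
      · cases t with
        | nil =>
          rw [erasureWeight_nil, zero_mul]
          have : ({v | v ∈ ([] : List V)} : Set V) = ∅ := by simp
          rw [this, sieved_empty, mul_zero]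
          simp
          omega
        | cons a t =>
          rw [ih (List.nodup_cons.1 hs).2 (by simpa using hu), List.reverse_cons (a := x),
            walkWeight_reverse_append]
          have : ((n + 1 : ℕ) : ℤ) + 1 - (x :: a :: t).length = (n : ℤ) + 1 - (a :: t).length := by
            simp
          rw [this]
          ring
      · rw [Finset.mul_sum]
        refine Finset.sum_congr rfl fun l hl => ?_
        have hl' := hset ▸ mem_freshLists.1 hl
        rw [ih (List.nodup_append.2 ⟨List.nodup_reverse.2 hl'.1, hs, ?_⟩) (by simpa using hu),
          mul_right_comm, ← walkWeight_reverse_append]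
        · have h1 : (l.reverse ++ x :: t).reverse ++ [x] = t.reverse ++ x :: (l ++ [x]) := by simp
          have h2 : {v | v ∈ l.reverse ++ x :: t} = insert x {v | v ∈ t} ∪ {v | v ∈ l} := by
            ext v
            simp
            tauto
          have h3 : (n : ℤ) + 1 - (l.reverse ++ x :: t).length =
              ((n + 1 : ℕ) : ℤ) + 1 - (x :: t).length - (l.length + 1 : ℕ) := by
            simp
            ring
          rw [h1, h2, h3, walkWeight_append_cons, List.reverse_cons]
          ring
        · rintro a ha _ hb rfl
          exact hl'.2 a (List.mem_reverse.1 ha) hb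

theorem SimplePath.totalWalkWeight_loopErasure {A : Matrix V V ℂ} (p : SimplePath A) (l : ℕ) :
    totalWalkWeight A {w | w ∈ walks A (p.toList.head p.ne_nil) (p.toList.getLast p.ne_nil) l ∧
        loopErasure w = p.toList} = p.weight * sieved A p.verts ((l : ℤ) - p.length) := by
  have hset : {w | w ∈ walks A (p.toList.head p.ne_nil) (p.toList.getLast p.ne_nil) l ∧
      loopErasure w = p.toList} = {w | w ∈ walks A (p.toList.head p.ne_nil)
        (p.toList.getLast p.ne_nil) l ∧ (eraseState w).1 = p.toList.reverse} := by
    ext w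
    simp only [Set.mem_ofPred_eq, loopErasure_eq, List.reverse_eq_iff]
  rw [hset, totalWalkWeight_eq_erasureWeight A _ _
      (by rw [List.head?_reverse, List.getLast?_eq_some_getLast p.ne_nil]),
    erasureWeight_eq A _ _ (List.nodup_reverse.2 p.nodup)
      (by rw [List.getLast?_reverse, List.head?_eq_some_head p.ne_nil])]
  have h1 : {v | v ∈ p.toList.reverse} = p.verts := by
    ext v
    simp [SimplePath.verts]
  have h2 : (l : ℤ) + 1 - p.toList.reverse.length = (l : ℤ) - p.length := by
    have := List.length_pos_iff.2 p.ne_nil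
    rw [List.length_reverse, SimplePath.length]
    omega
  rw [List.reverse_reverse, h1, h2, SimplePath.weight]

/-- Removing the final return to `v` leaves a walk whose loop-erasure is the cycle cut open at `v`;
the weight of the closing edge completes the path weight to the cycle weight. -/
theorem SimpleCycle.totalWalkWeight_lastErasedLoop {A : Matrix V V ℂ} (p : SimpleCycle A) {v : V}
    (hv : v ∈ p.verts) (l : ℕ) :
    totalWalkWeight A {w | w ∈ walks A v v l ∧ lastErasedLoop w = p.toCycle} =
      p.weight * sieved A p.verts ((l : ℤ) - p.length) := by
  obtain ⟨r, hr⟩ := exists_eq_coe_cons (show v ∈ p.toCycle from hv)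
  have hnd : (v :: r).Nodup := Cycle.nodup_coe_iff.1 (hr ▸ p.nodup)
  have hlen : p.length = r.length + 1 := by
    rw [SimpleCycle.length, hr]
    rfl
  have hverts : {y | y ∈ (v :: r).reverse} = p.verts := by
    ext y
    rw [SimpleCycle.verts, hr]
    simp [or_comm]
  rw [hr]
  cases l with
  | zero =>
    -- A walk of length zero erases nothing and has the default loop `Cycle.nil`; on the other side
    -- the length is negative.
    have : {w | w ∈ walks A v v 0 ∧ lastErasedLoop w = ((v :: r : List V) : Cycle V)} = ∅ := by
      refine Set.eq_empty_of_forall_notMem ?_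
      rintro w ⟨⟨-, h1, h2, -⟩, h3⟩
      obtain ⟨a, rfl⟩ := List.length_eq_one_iff.1 h1
      have h4 : lastErasedLoop [a] = Cycle.nil := rfl
      rw [h4, eq_comm, Cycle.coe_eq_nil] at h3
      simp at h3
    rw [this, totalWalkWeight, finsum_mem_empty, sieved_of_neg, mul_zero]
    omega
  | succ n =>
    have h1 : totalWalkWeight A {w | w ∈ walks A v v (n + 1) ∧
          lastErasedLoop w = ((v :: r : List V) : Cycle V)} =
        ∑ w ∈ ((vertexLists v n).filter fun w => (eraseState w).1 = (v :: r).reverse).image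
          fun w => w ++ [v], walkWeight A w := by
      refine finsum_mem_eq_sum_of_inter_support_eq _ ?_
      ext w
      simp only [Set.mem_inter_iff, Function.mem_support, Finset.coe_image, Finset.coe_filter,
        mem_vertexLists, Set.mem_ofPred_eq, walks, walkWeight_ne_zero_iff, Set.mem_image]
      constructor
      · rintro ⟨⟨⟨-, h1, h2, h3⟩, h4⟩, h5⟩
        obtain ⟨w, rfl⟩ := List.getLast?_eq_some_iff.1 h3
        have h6 : w.length = n + 1 := by simpa using h1
        have h7 : w.head? = some v := by
          cases w with
          | nil => simp at h6
          | cons a w => simpa using h2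
        rw [lastErasedLoop_append_head h7, coe_reverse_eq_iff hnd
          (by rw [getLast?_eraseState, h7])] at h4
        exact ⟨⟨w, ⟨⟨h6, h7⟩, h4⟩, rfl⟩, h5⟩
      · rintro ⟨⟨w, ⟨⟨h6, h7⟩, h4⟩, rfl⟩, h5⟩
        refine ⟨⟨⟨h5, by simp [h6], by simp [h7], by simp⟩, ?_⟩, h5⟩
        rw [lastErasedLoop_append_head h7, h4, List.reverse_reverse]
    have h2 : ∀ w ∈ (vertexLists v n).filter (fun w => (eraseState w).1 = (v :: r).reverse),
        walkWeight A (w ++ [v]) = walkWeight A w * stepWeight A (v :: r).reverse v := by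
      intro w hw
      rw [walkWeight_append_singleton, (Finset.mem_filter.1 hw).2]
    have h3 : ((n : ℤ) + 1 - (v :: r).reverse.length) = ((n + 1 : ℕ) : ℤ) - p.length := by
      rw [hlen]
      simp
    rw [h1, Finset.sum_image fun _ _ _ _ h => List.append_cancel_right h, Finset.sum_congr rfl h2,
      ← Finset.sum_mul]
    change erasureWeight A v n _ * _ = _
    rw [erasureWeight_eq A v n (List.nodup_reverse.2 hnd) (by simp), mul_right_comm,
      ← walkWeight_reverse_append, List.reverse_reverse, hverts, h3, SimpleCycle.weight, hr,
      cycleWeight_cons, List.cons_append]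

end LoopErasure

end

end HikeSieve

/-! ### Assembly of the main theorem. -/

open HikeSieve in
theorem mainTheorem4 {V : Type*} [Fintype V] [DecidableEq V] (A : Matrix V V ℂ) (lam : ℂ)
    (hlam0 : lam ≠ 0) (hlam : IsUniqueDominant A lam) :
    -- `f` is bounded and convergent; the divisions by `|Hₗ|` make sense for large `l`
    (∃ C : ℝ, ∀ n : ℤ, ‖zetaCoeff A lam n‖ ≤ C) ∧
    (∃ L : ℂ, Tendsto (fun l : ℕ => zetaCoeff A lam l) atTop (𝓝 L)) ∧
    (∀ᶠ l : ℕ in atTop, totalWeight (hikesOfLength A l) ≠ 0) ∧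
    -- simple cycles
    (∀ p : SimpleCycle A,
      -- closed walks with unique right prime divisor `p`, as hikes
      (∀ l : ℕ, totalWeight (walkHikes A l p)
        = p.weight * totalWeight (sievedHikes A ((l : ℤ) - p.length) (primesOff A p.verts))) ∧
      -- closed walks with a given starting point on `p` whose last erased loop is `p`
      (∀ v ∈ p.verts, ∀ l : ℕ,
        totalWalkWeight A {w | w ∈ walks A v v l ∧ lastErasedLoop w = p.toCycle}
          = totalWeight (walkHikes A l p)) ∧
      Tendsto (fun l : ℕ => totalWeight (walkHikes A l p) / totalWeight (hikesOfLength A l))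
        atTop (𝓝 (p.weight * mainTerm A lam p.verts p.length)) ∧
      Tendsto (fun l : ℕ => sieveRatio A p.verts p.length l)
        atTop (𝓝 (mainTerm A lam p.verts p.length)) ∧
      (∀ l : ℕ, totalWeight (hikesOfLength A l) ≠ 0 →
        HasSum (errTerm A lam p.verts p.length l)
          (sieveRatio A p.verts p.length l - mainTerm A lam p.verts p.length))) ∧
    -- simple paths
    (∀ p : SimplePath A,
      -- walks whose loop-erasure is `p`
      (∀ l : ℕ, totalWalkWeight A {w | w ∈ walks A (p.toList.head p.ne_nil)
            (p.toList.getLast p.ne_nil) l ∧ loopErasure w = p.toList}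
        = p.weight * totalWeight (sievedHikes A ((l : ℤ) - p.length) (primesOff A p.verts))) ∧
      Tendsto (fun l : ℕ => sieveRatio A p.verts p.length l)
        atTop (𝓝 (mainTerm A lam p.verts p.length)) ∧
      (∀ l : ℕ, totalWeight (hikesOfLength A l) ≠ 0 →
        HasSum (errTerm A lam p.verts p.length l)
          (sieveRatio A p.verts p.length l - mainTerm A lam p.verts p.length))) := by
  obtain ⟨L, hL, hlim⟩ := exists_tendsto_zetaCoeff hlam0 hlam
  refine ⟨exists_bound_zetaCoeff hlam0 hlam, ⟨L, hlim⟩,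
    eventually_totalWeight_ne_zero hlam0 hL hlim, fun p => ⟨?_, ?_, ?_, ?_, ?_⟩,
    fun p => ⟨?_, ?_, ?_⟩⟩
  · exact fun l => totalWeight_walkHikes p l
  · intro v hv l
    rw [p.totalWalkWeight_lastErasedLoop hv, totalWeight_walkHikes]
  · refine ((tendsto_sieveRatio hlam0 hL hlim p.verts p.length).const_mul p.weight).congr ?_
    intro l
    rw [totalWeight_walkHikes, mul_div_assoc]
    rfl
  · exact tendsto_sieveRatio hlam0 hL hlim p.verts p.length
  · exact fun l => hasSum_errTerm hlam0 p.verts p.length l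
  · exact fun l => p.totalWalkWeight_loopErasure l
  · exact tendsto_sieveRatio hlam0 hL hlim p.verts p.length
  · exact fun l => hasSum_errTerm hlam0 p.verts p.length l
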